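/- **Corollary (limiting density of states).** For a finite simple graph $G$ let the barycentric refinement $G_1$ be the graph whose vertices are the nonempty complete subgraphs of $G$, two different ones being adjacent if one is contained in the other; let $G_0=G$ and let $G_{m+1}$ be the barycentric refinement of $G_m$. If $\lambda_0\le\lambda_1\le\dots\le\lambda_{n-1}$ are the eigenvalues of the Laplacian $L=B-A$ ($B$ the diagonal degree matrix, $A$ the adjacency matrix) of a graph $G$ with $n$ vertices, let $F_G(x)=\lambda_{\lfloor nx\rfloor}$ for $x\in[0,1)$ and $F_G(1)=\lambda_{n-1}$. For every integer $d\ge 0$ there is a function $F_d\in L^1([0,1])$, monotone increasing and right-continuous on $[0,1)$, such that $F_{G_m}\to F_d$ in $L^1([0,1])$ as $m\to\infty$ for every finite simple graph $G$ whose largest complete subgraph has $d+1$ vertices (in particular for $G=K_{d+1}$). It defines a limiting density of states $\mu_d=F_d'$, which is a measure on $[0,1]$: there is exactly one Borel (nonnegative) measure $\mu_d$ on $\mathbb{R}$, concentrated on the open interval $(0,1)$, such that $$\mu_d((a,b])=F_d(b)-F_d(a)\qquad\text{for all } 0\le a\le b<1,$$ and such that $\mu_d$ is the distributional derivative of $F_d$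 on $(0,1)$: every smooth function $\varphi$ with compact support contained in $(0,1)$ is $\mu_d$-integrable and $$\int\varphi\,d\mu_d=-\int_0^1\varphi'(x)\,F_d(x)\,dx .$$ (The measure may have infinite total mass, since $F_d$ may be unbounded near $1$.) -/

import Mathlib

open MeasureTheory Set Filter Topology

universe u

/-- A finite simple graph together with its vertex type, so that graph constructions that change
the vertex set can be iterated. -/
structure FinGraph : Type (u + 1) where
  /-- The vertex set. -/
  V : Type u
  [fintypeV : Fintype V]
  /-- The graph. -/
  graph : SimpleGraph V

attribute [instance] FinGraph.fintypeV

/-- The barycentric refinement of a graph: its vertices are the (nonempty) complete subgraphs of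
`G`, given by their vertex sets, and two different ones are adjacent iff one contains the other. -/
def SimpleGraph.barycentric {V : Type u} (G : SimpleGraph V) :
    SimpleGraph {s : Finset V // s.Nonempty ∧ G.IsClique (s : Set V)} where
  Adj s t := s ≠ t ∧ (s.1 ⊆ t.1 ∨ t.1 ⊆ s.1)
  symm := ⟨fun _ _ h => ⟨h.1.symm, h.2.symm⟩⟩
  loopless := ⟨fun _ h => h.1 rfl⟩

namespace FinGraph

/-- The barycentric refinement of a finite simple graph. -/
noncomputable def refine (G : FinGraph.{u}) : FinGraph.{u} :=
  letI : Fintype {s : Finset G.V // s.Nonempty ∧ G.graph.IsClique (s : Set G.V)} :=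
    Fintype.ofFinite _
  ⟨_, G.graph.barycentric⟩

/-- The `m`-th barycentric refinement `G_m`, with `G_0 = G`. -/
noncomputable def iterRefine (G : FinGraph.{u}) (m : ℕ) : FinGraph.{u} :=
  refine^[m] G

/-- The number of vertices. -/
def order (G : FinGraph.{u}) : ℕ := Fintype.card G.V

open Classical in
/-- The graph Laplacian, degree matrix minus adjacency matrix, is symmetric. -/
theorem laplacian_isHermitian (G : FinGraph.{u}) : (G.graph.lapMatrix ℝ).IsHermitian :=
  (G.graph.posSemidef_lapMatrix ℝ).isHermitian

open Classical in
/-- The Laplacian eigenvalues `λ_0 ≤ λ_1 ≤ ⋯ ≤ λ_{n-1}`, with multiplicity, in increasing order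
(Mathlib's `eigenvalues₀` is decreasing). -/
noncomputable def eigenvalue (G : FinGraph.{u}) (k : Fin G.order) : ℝ :=
  G.laplacian_isHermitian.eigenvalues₀ k.rev

open Classical in
/-- The eigenvalues are listed in increasing order. -/
theorem eigenvalue_monotone (G : FinGraph.{u}) : Monotone G.eigenvalue := fun _ _ h =>
  G.laplacian_isHermitian.eigenvalues₀_antitone (Fin.rev_le_rev.mpr h)

/-- The spectral function `F_G(x) = λ_{⌊n x⌋}` on `[0, 1]`, where `n` is the number of vertices
and `F_G(1) = λ_{n-1}` (the graph without vertices gets the value `0`). -/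
noncomputable def spectralFunction (G : FinGraph.{u}) (x : ℝ) : ℝ :=
  if h : 0 < G.order then
    G.eigenvalue ⟨min ⌊(G.order : ℝ) * x⌋₊ (G.order - 1),
      lt_of_le_of_lt (min_le_right _ _) (Nat.sub_lt h one_pos)⟩
  else 0

end FinGraph

/-! Write Q = (d+1)!. After many refinements all graphs G of clique number d+1 look alike: up to a
negligible part, G_m consists of N copies of the refined simplex, one for each (d+1)-clique of G.
The copies (`exists_patchFamily`, `PatchFamily.barycentric`) are controlled by exceptional sets B: a
vertex outside B is interior to one copy and lies in no other, and after refining, a simplex is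
exceptional iff all its vertices were. A (d+1)-clique not inside B has a full flag that starts at a
vertex outside B; no member of this flag lies inside B. So of the Q cliques that subdivide it at
most Q-1 meet the new exceptional set (`flagCount_lt`). Giving a k-clique the weight R^k with R
large makes the contribution of non-full flags cost only ε. The exceptional parts therefore grow at
rate at most Q-1+ε and whole clique sums at rate at most Q+ε, while the order grows at least like
Q^m.

Spectrally, deleting the edges that meet B lowers the quadratic form of the Laplacian. By Weyl's
principle the number of eigenvalues above t can only drop, and the integral over t > 0 of this drop
is the drop of the trace, twice the number of deleted edges. What remains is N copies of the
corresponding graph for the simplex, plus isolated vertices, so the remaining counting functions are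
proportional. A spectral function is the inverse of a normalized counting function, so closeness in
L¹ passes from the latter to the former (`eLpNorm_spectralFunction_sub_le`). This gives a
geometrically small distance between the spectral functions of G_m and of the refined simplex
(`exists_eLpNorm_sub_simplex_le`). Taking for G the refinement of the simplex itself shows that the
sequence of the simplex is Cauchy; the same estimate transfers its limit to every G. An almost
everywhere convergent subsequence yields a monotone right-continuous version.

The measure is the image of Lebesgue measure under the generalized inverse of F. The derivative
formula is Fubini's theorem for the region under the graph of F, and uniqueness holds because the
increments determine the measure on each (0,c] with c < 1, where it is finite. -/

/-! ### Eigenvalue counts of symmetric matrices -/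

namespace Matrix.IsHermitian

variable {n : Type*} [Fintype n] [DecidableEq n] {A B : Matrix n n ℝ}

/-- The quadratic form of a real symmetric matrix in an orthonormal basis of eigenvectors. -/
theorem dotProduct_mulVec_eq_sum (hA : A.IsHermitian) (x : EuclideanSpace ℝ n) :
    x.ofLp ⬝ᵥ A *ᵥ x.ofLp
      = ∑ i, hA.eigenvalues i * inner ℝ (hA.eigenvectorBasis i) x ^ 2 := by
  have h1 : x.ofLp ⬝ᵥ A *ᵥ x.ofLp = inner ℝ x (WithLp.toLp 2 (A *ᵥ x.ofLp)) := by
    rw [EuclideanSpace.inner_eq_star_dotProduct, dotProduct_comm]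
    simp
  rw [h1, ← hA.eigenvectorBasis.sum_inner_mul_inner]
  refine Finset.sum_congr rfl fun i _ => ?_
  have h2 : inner ℝ (hA.eigenvectorBasis i) (WithLp.toLp 2 (A *ᵥ x.ofLp))
      = hA.eigenvalues i * inner ℝ (hA.eigenvectorBasis i) x := by
    rw [EuclideanSpace.inner_eq_star_dotProduct, EuclideanSpace.inner_eq_star_dotProduct]
    have hs : Aᵀ = A := by simpa [IsHermitian, conjTranspose] using hA
    simp only [star_trivial]
    rw [dotProduct_comm, dotProduct_mulVec, ← mulVec_transpose, hs, hA.mulVec_eigenvectorBasis,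
      smul_dotProduct, dotProduct_comm, smul_eq_mul]
  rw [h2, real_inner_comm]
  ring

/-- Weyl's monotonicity principle, for the number of eigenvalues above a threshold. -/
theorem card_lt_eigenvalues_le (hA : A.IsHermitian) (hB : B.IsHermitian)
    (hAB : ∀ x : n → ℝ, x ⬝ᵥ A *ᵥ x ≤ x ⬝ᵥ B *ᵥ x) (t : ℝ) :
    Fintype.card {i // t < hA.eigenvalues i} ≤ Fintype.card {i // t < hB.eigenvalues i} := by
  -- A vector in the kernel is spanned by eigenvectors of A above t and by eigenvectors of B up to
  -- t. The first makes its A-form larger than t‖x‖² unless it vanishes, the second makes its B-form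
  -- at most t‖x‖². Injectivity then yields the count by comparing dimensions.
  let g : EuclideanSpace ℝ n →ₗ[ℝ] (({i // ¬ t < hA.eigenvalues i} → ℝ) ×
      ({i // t < hB.eigenvalues i} → ℝ)) :=
    LinearMap.prod
      (LinearMap.pi fun i => (innerₛₗ ℝ (hA.eigenvectorBasis i.1)))
      (LinearMap.pi fun i => (innerₛₗ ℝ (hB.eigenvectorBasis i.1)))
  have hg : Function.Injective g := by
    rw [← LinearMap.ker_eq_bot, LinearMap.ker_eq_bot']
    intro x hx
    have hxA : ∀ i, ¬ t < hA.eigenvalues i → inner ℝ (hA.eigenvectorBasis i) x = 0 :=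
      fun i hi => congrFun (congrArg Prod.fst hx) ⟨i, hi⟩
    have hxB : ∀ i, t < hB.eigenvalues i → inner ℝ (hB.eigenvectorBasis i) x = 0 :=
      fun i hi => congrFun (congrArg Prod.snd hx) ⟨i, hi⟩
    have hnA := hA.eigenvectorBasis.sum_sq_norm_inner_right x
    have hnB := hB.eigenvectorBasis.sum_sq_norm_inner_right x
    simp only [Real.norm_eq_abs, sq_abs] at hnA hnB
    have hB' : x.ofLp ⬝ᵥ B *ᵥ x.ofLp ≤ t * ‖x‖ ^ 2 := by
      rw [hB.dotProduct_mulVec_eq_sum, ← hnB, Finset.mul_sum]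
      refine Finset.sum_le_sum fun i _ => ?_
      by_cases hi : t < hB.eigenvalues i
      · simp [hxB i hi]
      · exact mul_le_mul_of_nonneg_right (not_lt.1 hi) (sq_nonneg _)
    have hle : ∑ i, (hA.eigenvalues i - t) * inner ℝ (hA.eigenvectorBasis i) x ^ 2 ≤ 0 := by
      have := (hAB x.ofLp).trans hB'
      rw [hA.dotProduct_mulVec_eq_sum, ← hnA, Finset.mul_sum] at this
      simp only [sub_mul, Finset.sum_sub_distrib]
      linarith
    have hnn : ∀ i ∈ Finset.univ,
        0 ≤ (hA.eigenvalues i - t) * inner ℝ (hA.eigenvectorBasis i) x ^ 2 := by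
      intro i _
      by_cases hi : t < hA.eigenvalues i
      · exact mul_nonneg (by linarith) (sq_nonneg _)
      · simp [hxA i hi]
    have hz := (Finset.sum_eq_zero_iff_of_nonneg hnn).1 (le_antisymm hle (Finset.sum_nonneg hnn))
    have hall : ∀ i, inner ℝ (hA.eigenvectorBasis i) x = 0 := by
      intro i
      by_cases hi : t < hA.eigenvalues i
      · have := hz i (Finset.mem_univ i)
        simpa [(sub_pos.2 hi).ne'] using this
      · exact hxA i hi
    have : ‖x‖ ^ 2 = 0 := by rw [← hnA]; simp [hall]
    simpa using this
  have h := LinearMap.finrank_le_finrank_of_injective hg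
  simp only [finrank_euclideanSpace, Module.finrank_prod, Module.finrank_fintype_fun_eq_card] at h
  have hc := Fintype.card_subtype_compl (fun i => t < hA.eigenvalues i)
  have hc' := Fintype.card_subtype_le (fun i => t < hA.eigenvalues i)
  omega

end Matrix.IsHermitian

namespace Matrix

theorem charpoly_blockDiagonal {n o R : Type*} [Fintype n] [DecidableEq n] [Fintype o]
    [DecidableEq o] [CommRing R] (M : o → Matrix n n R) :
    (blockDiagonal M).charpoly = ∏ k, (M k).charpoly := by
  have : (blockDiagonal M).charmatrix = blockDiagonal fun k => (M k).charmatrix := by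
    ext1 ⟨i, k⟩ ⟨j, l⟩
    by_cases hk : k = l <;> by_cases hi : i = j <;>
      simp [blockDiagonal_apply, hk, hi]
  simp only [charpoly, this, det_blockDiagonal]

end Matrix

/-! ### The counting function of Laplacian eigenvalues -/

namespace SimpleGraph

open Classical in
/-- The number of Laplacian eigenvalues above `t`, with multiplicity. -/
noncomputable def eigenvalueCount {V : Type*} [Fintype V] (G : SimpleGraph V) (t : ℝ) : ℕ :=
  Fintype.card {i // t < (G.posSemidef_lapMatrix ℝ).isHermitian.eigenvalues i}

variable {V W : Type*} [Fintype V] [Fintype W]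

open Classical in
-- The Laplacian form is a sum of squared differences over the edges, so more edges mean a larger
-- form, and Weyl's principle applies.
theorem eigenvalueCount_mono {G H : SimpleGraph V} (h : G ≤ H) (t : ℝ) :
    G.eigenvalueCount t ≤ H.eigenvalueCount t := by
  refine Matrix.IsHermitian.card_lt_eigenvalues_le _ _ (fun x => ?_) t
  rw [← Matrix.toLinearMap₂'_apply', ← Matrix.toLinearMap₂'_apply', lapMatrix_toLinearMap₂',
    lapMatrix_toLinearMap₂']
  gcongr with i _ j _
  split_ifs with h1 h2 h2
  · exact le_rfl
  · exact absurd (h h1) h2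
  · positivity
  · exact le_rfl

open Classical in
-- In terms of the characteristic polynomial the count can be computed for block matrices and is
-- invariant under relabelling the vertices.
theorem eigenvalueCount_eq_roots (G : SimpleGraph V) (t : ℝ) :
    G.eigenvalueCount t
      = ((G.lapMatrix ℝ).charpoly.roots.filter (t < ·)).card := by
  rw [(G.posSemidef_lapMatrix ℝ).isHermitian.roots_charpoly_eq_eigenvalues, Multiset.filter_map,
    Multiset.card_map, eigenvalueCount, Fintype.card_subtype]
  rfl

open Classical in
theorem measurable_eigenvalueCount (G : SimpleGraph V) : Measurable G.eigenvalueCount := by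
  have : Antitone G.eigenvalueCount := fun s t h =>
    Fintype.card_subtype_mono _ _ fun i (hi : t < _) => h.trans_lt hi
  exact this.measurable

open Classical in
/-- The layer cake formula for the trace of the Laplacian. -/
theorem lintegral_eigenvalueCount (G : SimpleGraph V) :
    ∫⁻ t in Ioi (0 : ℝ), (G.eigenvalueCount t : ENNReal) = ((∑ v, G.degree v : ℕ) : ENNReal) := by
  have hG := G.posSemidef_lapMatrix ℝ
  have h1 : ∀ t : ℝ, (G.eigenvalueCount t : ENNReal)
      = ∑ i, (Iio (hG.isHermitian.eigenvalues i)).indicator (fun _ => (1 : ENNReal)) t := by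
    intro t
    rw [eigenvalueCount, Fintype.card_subtype, Finset.card_filter]
    push_cast
    exact Finset.sum_congr rfl fun i _ => by simp [indicator_apply]
  simp_rw [h1]
  rw [lintegral_finsetSum]
  · have h2 : ∀ i, ∫⁻ t in Ioi (0 : ℝ),
        (Iio (hG.isHermitian.eigenvalues i)).indicator (fun _ => (1 : ENNReal)) t
        = ENNReal.ofReal (hG.isHermitian.eigenvalues i) := by
      intro i
      rw [lintegral_indicator_const measurableSet_Iio, one_mul, Measure.restrict_apply
        measurableSet_Iio, inter_comm, Ioi_inter_Iio, Real.volume_Ioo, sub_zero]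
    simp_rw [h2]
    rw [← ENNReal.ofReal_sum_of_nonneg fun i _ => hG.eigenvalues_nonneg i]
    have h3 := hG.isHermitian.trace_eq_sum_eigenvalues
    simp only [RCLike.ofReal_real_eq_id, id] at h3
    rw [← h3, ← ENNReal.ofReal_natCast]
    congr 1
    simp [Matrix.trace, lapMatrix, degMatrix]
  · intro i _
    exact measurable_const.indicator measurableSet_Iio

open Classical in
/-- The eigenvalues above `t ≥ 0` of a graph that consists of copies of `K` and isolated
vertices. -/
theorem eigenvalueCount_copies {ι : Type*} [Fintype ι] (G : SimpleGraph V) (K : SimpleGraph W)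
    (f : W × ι ↪ V)
    (hf : ∀ v w, G.Adj v w ↔ ∃ i a b, K.Adj a b ∧ f (a, i) = v ∧ f (b, i) = w)
    {t : ℝ} (ht : 0 ≤ t) :
    G.eigenvalueCount t = Fintype.card ι * K.eigenvalueCount t := by
  let e : (W × ι) ⊕ {v // v ∉ range f} ≃ V :=
    (Equiv.sumCongr (Equiv.ofInjective f f.injective) (Equiv.refl _)).trans
      (Equiv.sumCompl (· ∈ range f))
  have hel : ∀ p, e (Sum.inl p) = f p := fun p => rfl
  have her : ∀ v, e (Sum.inr v) = v.1 := fun v => rfl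
  have hadj : ∀ a i b j, G.Adj (f (a, i)) (f (b, j)) ↔ i = j ∧ K.Adj a b := by
    intro a i b j
    rw [hf]
    constructor
    · rintro ⟨k, x, y, hxy, h1, h2⟩
      obtain ⟨rfl, rfl⟩ := Prod.mk.inj (f.injective h1)
      obtain ⟨rfl, rfl⟩ := Prod.mk.inj (f.injective h2)
      exact ⟨rfl, hxy⟩
    · rintro ⟨rfl, h⟩
      exact ⟨i, a, b, h, rfl, rfl⟩
  have hdeg : ∀ a i, G.degree (f (a, i)) = K.degree a := by
    intro a i
    have : G.neighborFinset (f (a, i))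
        = (K.neighborFinset a).map ⟨fun b => f (b, i), fun b c h =>
          (Prod.mk.inj (f.injective h)).1⟩ := by
      ext v
      simp only [mem_neighborFinset, Finset.mem_map]
      constructor
      · intro h
        obtain ⟨k, x, y, hxy, h1, h2⟩ := (hf _ _).1 h
        obtain ⟨rfl, rfl⟩ := Prod.mk.inj (f.injective h1)
        exact ⟨y, hxy, h2⟩
      · rintro ⟨b, hb, rfl⟩
        exact (hadj _ _ _ _).2 ⟨rfl, hb⟩
    rw [← card_neighborFinset_eq_degree, this, Finset.card_map, card_neighborFinset_eq_degree]
  have hnone : ∀ v, v ∉ range f → ∀ w, ¬ G.Adj v w := by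
    rintro v hv w h
    obtain ⟨k, x, y, -, h1, -⟩ := (hf _ _).1 h
    exact hv ⟨_, h1⟩
  -- With the vertices sorted into copies and the rest, the Laplacian is block diagonal; the
  -- isolated vertices form a zero block.
  have hL : Matrix.reindex e.symm e.symm (G.lapMatrix ℝ)
      = Matrix.fromBlocks (Matrix.blockDiagonal fun _ : ι => K.lapMatrix ℝ) 0 0 0 := by
    ext x y
    rcases x with ⟨a, i⟩ | v <;> rcases y with ⟨b, j⟩ | w
    · simp only [Matrix.reindex_apply, Matrix.submatrix_apply, Equiv.symm_symm, hel,
        Matrix.fromBlocks_apply₁₁, Matrix.blockDiagonal_apply, lapMatrix, degMatrix,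
        Matrix.sub_apply, Matrix.diagonal_apply, adjMatrix_apply, hadj, hdeg, f.injective.eq_iff,
        Prod.mk.injEq]
      by_cases hij : i = j <;> simp [hij]
    · have h : ¬ G.Adj (f (a, i)) w.1 := fun h => hnone _ w.2 _ h.symm
      have h' : f (a, i) ≠ w.1 := fun h => w.2 ⟨_, h⟩
      simp [hel, her, lapMatrix, degMatrix, h, h']
    · have h : ¬ G.Adj v.1 (f (b, j)) := hnone _ v.2 _
      have h' : v.1 ≠ f (b, j) := fun h => v.2 ⟨_, h.symm⟩
      simp [hel, her, lapMatrix, degMatrix, h, h']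
    · have h : ¬ G.Adj v.1 w.1 := hnone _ v.2 _
      have h' : G.degree w.1 = 0 := by
        rw [← card_neighborFinset_eq_degree, Finset.card_eq_zero]
        ext z
        simp [hnone _ w.2 z]
      by_cases hvw : v.1 = w.1
      · simp [her, lapMatrix, degMatrix, hvw, h']
      · simp [her, lapMatrix, degMatrix, h, hvw]
  have hchar : (G.lapMatrix ℝ).charpoly
      = (K.lapMatrix ℝ).charpoly ^ Fintype.card ι
        * Polynomial.X ^ Fintype.card {v // v ∉ range f} := by
    rw [← Matrix.charpoly_reindex e.symm, hL, Matrix.charpoly_fromBlocks_zero₁₂,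
      Matrix.charpoly_blockDiagonal, Finset.prod_const, Finset.card_univ, Matrix.charpoly_zero]
  have h0 : (K.lapMatrix ℝ).charpoly ≠ 0 := (Matrix.charpoly_monic _).ne_zero
  rw [eigenvalueCount_eq_roots, eigenvalueCount_eq_roots, hchar, Polynomial.roots_mul
    (mul_ne_zero (pow_ne_zero _ h0) (pow_ne_zero _ Polynomial.X_ne_zero)), Polynomial.roots_pow,
    Polynomial.roots_X_pow, Multiset.filter_add, Multiset.card_add, Multiset.filter_nsmul,
    Multiset.card_nsmul, Multiset.filter_nsmul, Multiset.card_nsmul]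
  -- The zero block contributes only the root 0, which is not above t because t ≥ 0.
  simp [Multiset.filter_singleton, ht.not_gt]

end SimpleGraph

/-! ### Spectral functions as inverses of counting functions -/

/-- The values above t occupy a final segment of the list, so position k belongs to it exactly when
the segment has at least n - k entries. -/
theorem Monotone.lt_iff_card_le {n : ℕ} {f : Fin n → ℝ} (hf : Monotone f) (t : ℝ) (k : Fin n) :
    t < f k ↔ n ≤ k + Fintype.card {i // t < f i} := by
  rw [Fintype.card_subtype]
  constructor
  · intro h
    have : Finset.Ici k ⊆ Finset.univ.filter fun i => t < f i := fun i hi => by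
      simpa using h.trans_le (hf (Finset.mem_Ici.1 hi))
    have := Finset.card_le_card this
    rw [Fin.card_Ici] at this
    omega
  · intro h
    by_contra h'
    have : (Finset.univ.filter fun i => t < f i) ⊆ Finset.Ioi k := fun i hi => by
      rw [Finset.mem_Ioi]
      by_contra hik
      exact h' ((Finset.mem_filter.1 hi).2.trans_le (hf (not_lt.1 hik)))
    have := Finset.card_le_card this
    rw [Fin.card_Ioi] at this
    have := k.2
    omega

namespace FinGraph

variable (G H : FinGraph.{u})

open Classical in
theorem eigenvalue_eq_eigenvalues (k : Fin G.order) :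
    G.eigenvalue k = G.laplacian_isHermitian.eigenvalues
      (Fintype.equivOfCardEq (Fintype.card_fin _) k.rev) :=
  congrArg G.laplacian_isHermitian.eigenvalues₀ (Equiv.symm_apply_apply _ _).symm

open Classical in
theorem card_lt_eigenvalue (t : ℝ) :
    Fintype.card {k // t < G.eigenvalue k} = G.graph.eigenvalueCount t := by
  refine Fintype.card_congr (Equiv.subtypeEquiv
    (Fin.revPerm.trans (Fintype.equivOfCardEq (Fintype.card_fin _))) fun k => ?_)
  exact iff_of_eq (congrArg (t < ·) (G.eigenvalue_eq_eigenvalues k))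

open Classical in
theorem eigenvalue_nonneg (k : Fin G.order) : 0 ≤ G.eigenvalue k := by
  rw [eigenvalue_eq_eigenvalues]
  exact (G.graph.posSemidef_lapMatrix ℝ).eigenvalues_nonneg _

theorem spectralFunction_nonneg (x : ℝ) : 0 ≤ G.spectralFunction x := by
  unfold spectralFunction
  split_ifs
  · exact G.eigenvalue_nonneg _
  · exact le_rfl

theorem spectralFunction_mono : Monotone G.spectralFunction := by
  intro x y h
  unfold spectralFunction
  split_ifs
  · refine G.eigenvalue_monotone (Fin.mk_le_mk.2 ?_)
    gcongr
  · exact le_rfl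

theorem memLp_spectralFunction :
    MemLp G.spectralFunction 1 (volume.restrict (Icc (0 : ℝ) 1)) := by
  rw [memLp_one_iff_integrable]
  exact (G.spectralFunction_mono.monotoneOn _).integrableOn_isCompact isCompact_Icc

variable {G H}

/-- This is the inversion relation between the spectral function and the normalized counting
function. For x < 1 the floor is below the order, so the truncation in `spectralFunction` has no
effect. -/
theorem lt_spectralFunction_iff (hG : 0 < G.order) {x : ℝ} (hx : x ∈ Ico (0 : ℝ) 1) (t : ℝ) :
    t < G.spectralFunction x ↔ 1 - (G.graph.eigenvalueCount t : ℝ) / G.order ≤ x := by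
  have hG' : (0 : ℝ) < G.order := by exact_mod_cast hG
  have hfl : ⌊(G.order : ℝ) * x⌋₊ < G.order := by
    rw [Nat.floor_lt (mul_nonneg hG'.le hx.1)]
    nlinarith [hx.2]
  rw [spectralFunction, dif_pos hG, G.eigenvalue_monotone.lt_iff_card_le, card_lt_eigenvalue]
  simp only [min_eq_left (Nat.le_sub_one_of_lt hfl)]
  rw [sub_le_comm, sub_le_iff_le_add', ← mul_le_mul_iff_right₀ hG', mul_add,
    mul_div_cancel₀ _ hG'.ne', mul_one, ← sub_le_iff_le_add, ← tsub_le_iff_right,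
    Nat.le_floor_iff (mul_nonneg hG'.le hx.1)]
  have hle : G.graph.eigenvalueCount t ≤ G.order := by
    rw [← card_lt_eigenvalue]
    exact (Fintype.card_subtype_le _).trans (Fintype.card_fin _).le
  rw [Nat.cast_sub hle]

/-- The `L¹` distance of two spectral functions is controlled by the `L¹` distance of the
normalized eigenvalue counting functions. -/
theorem eLpNorm_spectralFunction_sub_le (hG : 0 < G.order) (hH : 0 < H.order) :
    eLpNorm (fun x => G.spectralFunction x - H.spectralFunction x) 1
        (volume.restrict (Icc (0 : ℝ) 1))
      ≤ ∫⁻ t in Ioi (0 : ℝ), ENNReal.ofReal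
        |(G.graph.eigenvalueCount t : ℝ) / G.order - (H.graph.eigenvalueCount t : ℝ) / H.order| := by
  have hmG := G.spectralFunction_mono.measurable
  have hmH := H.spectralFunction_mono.measurable
  -- The region between the two graphs. Its vertical slices have length |F_G - F_H|; its slices at
  -- height t lie in an interval whose length is the difference of the normalized counts. Tonelli's
  -- theorem compares the two.
  let S : Set (ℝ × ℝ) := {p | min (G.spectralFunction p.1) (H.spectralFunction p.1) ≤ p.2 ∧
    p.2 < max (G.spectralFunction p.1) (H.spectralFunction p.1)}
  have hS : MeasurableSet S := by
    have h1 : Measurable fun p : ℝ × ℝ => G.spectralFunction p.1 := hmG.comp measurable_fst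
    have h2 : Measurable fun p : ℝ × ℝ => H.spectralFunction p.1 := hmH.comp measurable_fst
    exact (measurableSet_le (h1.min h2) measurable_snd).inter
      (measurableSet_lt measurable_snd (h1.max h2))
  rw [eLpNorm_one_eq_lintegral_enorm, ← restrict_Ico_eq_restrict_Icc]
  have h1 : ∀ x, ‖G.spectralFunction x - H.spectralFunction x‖ₑ
      = ∫⁻ t in Ioi (0 : ℝ), S.indicator (fun _ => (1 : ENNReal)) (x, t) := by
    intro x
    set a := G.spectralFunction x
    set b := H.spectralFunction x
    have ha : 0 ≤ a := G.spectralFunction_nonneg x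
    have hb : 0 ≤ b := H.spectralFunction_nonneg x
    have : ∀ t, S.indicator (fun _ => (1 : ENNReal)) (x, t)
        = (Ico (min a b) (max a b)).indicator (fun _ => 1) t := fun t => rfl
    simp_rw [this]
    rw [lintegral_indicator_const measurableSet_Ico, one_mul, restrict_Ioi_eq_restrict_Ici,
      Measure.restrict_apply measurableSet_Ico, inter_eq_left.2, Real.volume_Ico,
      max_sub_min_eq_abs', ← Real.enorm_eq_ofReal_abs]
    exact fun t ht => (le_min ha hb).trans ht.1
  simp_rw [h1]
  rw [lintegral_lintegral_swap (f := fun x t => S.indicator (fun _ => (1 : ENNReal)) (x, t))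
    (measurable_const.indicator hS).aemeasurable]
  refine lintegral_mono fun t => ?_
  set p := (G.graph.eigenvalueCount t : ℝ) / G.order
  set q := (H.graph.eigenvalueCount t : ℝ) / H.order
  calc ∫⁻ x in Ico (0 : ℝ) 1, S.indicator (fun _ => (1 : ENNReal)) (x, t)
      ≤ ∫⁻ x in Ico (0 : ℝ) 1, (Ico (min (1 - p) (1 - q)) (max (1 - p) (1 - q))).indicator
          (fun _ => (1 : ENNReal)) x := by
        refine setLIntegral_mono' measurableSet_Ico fun x hx => ?_
        by_cases hxS : (x, t) ∈ S
        · rw [indicator_of_mem hxS, indicator_of_mem]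
          have hg := lt_spectralFunction_iff hG hx t
          have hh := lt_spectralFunction_iff hH hx t
          obtain ⟨h2, h3⟩ := hxS
          simp only at h2 h3
          rw [lt_max_iff, hg, hh] at h3
          rw [min_le_iff, ← not_lt, ← not_lt, hg, hh] at h2
          refine ⟨min_le_iff.2 h3, lt_max_iff.2 ?_⟩
          rwa [not_le, not_le] at h2
        · simp [hxS]
    _ ≤ ∫⁻ x, (Ico (min (1 - p) (1 - q)) (max (1 - p) (1 - q))).indicator
          (fun _ => (1 : ENNReal)) x := setLIntegral_le_lintegral _ _
    _ = ENNReal.ofReal |p - q| := by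
        rw [lintegral_indicator_const measurableSet_Ico, one_mul, Real.volume_Ico,
          max_sub_min_eq_abs', abs_sub_comm]
        congr 2
        ring

end FinGraph

/-! ### Chains and full flags in a simplex -/

section Chains

variable {V : Type*}

open Classical in
/-- The chains of nonempty finite sets with largest element `s` that have a member inside `B`. -/
noncomputable def chainsWithTop (B : Set V) (s : Finset V) : Finset (Finset (Finset V)) :=
  {c ∈ s.powerset.powerset | ∅ ∉ c ∧ IsChain (· ⊆ ·) (c : Set (Finset V)) ∧ s ∈ c ∧
    ∃ t ∈ c, (t : Set V) ⊆ B}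

theorem mem_chainsWithTop {B : Set V} {s : Finset V} {c : Finset (Finset V)} :
    c ∈ chainsWithTop B s ↔ (∀ t ∈ c, t ⊆ s) ∧ ∅ ∉ c ∧ IsChain (· ⊆ ·) (c : Set (Finset V)) ∧
      s ∈ c ∧ ∃ t ∈ c, (t : Set V) ⊆ B := by
  simp [chainsWithTop, Finset.subset_iff]

theorem card_chainsWithTop_le (B : Set V) (s : Finset V) :
    (chainsWithTop B s).card ≤ 2 ^ 2 ^ s.card := by
  classical
  refine (Finset.card_le_card (Finset.filter_subset _ _)).trans ?_
  rw [Finset.card_powerset, Finset.card_powerset]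

/-- On a chain the cardinality is injective, and it takes values between 1 and the size of the top.
-/
theorem card_le_of_mem_chainsWithTop {B : Set V} {s : Finset V} {c : Finset (Finset V)}
    (hc : c ∈ chainsWithTop B s) : c.card ≤ s.card := by
  obtain ⟨h1, h2, h3, -, -⟩ := mem_chainsWithTop.1 hc
  have := Finset.card_le_card_of_injOn (s := c) (t := Finset.Icc 1 s.card) Finset.card
    (fun t ht => by
      have hne : t.Nonempty := Finset.nonempty_iff_ne_empty.2 fun h => h2 (h ▸ ht)
      exact Finset.mem_coe.2 (Finset.mem_Icc.2 ⟨hne.card_pos, Finset.card_le_card (h1 t ht)⟩))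
    (fun t ht u hu h => by
      rcases h3.total ht hu with h' | h'
      · exact Finset.eq_of_subset_of_card_le h' h.ge
      · exact (Finset.eq_of_subset_of_card_le h' h.le).symm)
  simpa using this

theorem nonempty_of_mem_chainsWithTop {B : Set V} {s : Finset V} {c : Finset (Finset V)}
    (hc : c ∈ chainsWithTop B s) : s.Nonempty := by
  obtain ⟨-, h2, -, h4, -⟩ := mem_chainsWithTop.1 hc
  exact Finset.nonempty_iff_ne_empty.2 fun h => h2 (h ▸ h4)

theorem exists_mem_of_mem_chainsWithTop {B : Set V} {s : Finset V} {c : Finset (Finset V)}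
    (hc : c ∈ chainsWithTop B s) : ∃ v ∈ s, v ∈ B := by
  obtain ⟨h1, h2, -, -, t, ht, htB⟩ := mem_chainsWithTop.1 hc
  obtain ⟨v, hv⟩ := Finset.nonempty_iff_ne_empty.2 fun h => h2 (h ▸ ht : ∅ ∈ c)
  exact ⟨v, h1 t ht hv, htB hv⟩

theorem IsChain.exists_finset_top {c : Finset (Finset V)}
    (hc : IsChain (· ⊆ ·) (c : Set (Finset V))) (hne : c.Nonempty) :
    ∃ s ∈ c, ∀ t ∈ c, t ⊆ s := by
  obtain ⟨s, hs, hmax⟩ := c.exists_max_image Finset.card hne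
  refine ⟨s, hs, fun t ht => ?_⟩
  rcases hc.total ht hs with h | h
  · exact h
  · exact (Finset.eq_of_subset_of_card_le h (hmax t ht)).ge

/-- The number of full flags of `s` that have a member inside `B`. -/
noncomputable def flagCount (B : Set V) (s : Finset V) : ℕ :=
  ((chainsWithTop B s).filter fun c => c.card = s.card).card

open Classical in
-- Removing the top of a full flag leaves a full flag of a facet, and conversely.
theorem flagCount_eq_sum_erase (B : Set V) {s : Finset V} (hs : 2 ≤ s.card) :
    flagCount B s = ∑ v ∈ s, flagCount B (s.erase v) := by
  unfold flagCount
  rw [← Finset.card_sigma]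
  symm
  refine Finset.card_bij (fun p _ => insert s p.2) ?_ ?_ ?_
  · rintro ⟨v, c⟩ hp
    simp only [Finset.mem_sigma, Finset.mem_filter] at hp ⊢
    obtain ⟨hv, hc, hcard⟩ := hp
    obtain ⟨h1, h2, h3, h4, t, ht, htB⟩ := mem_chainsWithTop.1 hc
    have hsc : s ∉ c := fun h => Finset.notMem_erase v s (h1 s h hv)
    have hsub : ∀ t ∈ c, t ⊆ s := fun t ht => (h1 t ht).trans (Finset.erase_subset _ _)
    refine ⟨mem_chainsWithTop.2 ⟨?_, ?_, ?_, Finset.mem_insert_self _ _, t,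
      Finset.mem_insert_of_mem ht, htB⟩, ?_⟩
    · intro u hu
      rcases Finset.mem_insert.1 hu with rfl | hu
      · exact Finset.Subset.refl _
      · exact hsub u hu
    · intro h
      rcases Finset.mem_insert.1 h with h | h
      · rw [← h] at hs
        simp at hs
      · exact h2 h
    · rw [Finset.coe_insert]
      exact h3.insert fun u hu _ => Or.inr (hsub u hu)
    · rw [Finset.card_insert_of_notMem hsc, hcard, Finset.card_erase_of_mem hv]
      omega
  · rintro ⟨v, c⟩ hp ⟨w, c'⟩ hp' heq
    simp only [Finset.mem_sigma, Finset.mem_filter] at hp hp' heq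
    obtain ⟨h1, -, -, h4, -⟩ := mem_chainsWithTop.1 hp.2.1
    obtain ⟨h1', -, -, h4', -⟩ := mem_chainsWithTop.1 hp'.2.1
    have hsc : s ∉ c := fun h => Finset.notMem_erase v s (h1 s h hp.1)
    have hsc' : s ∉ c' := fun h => Finset.notMem_erase w s (h1' s h hp'.1)
    have hcc : c = c' := by
      rw [← Finset.erase_insert hsc, heq, Finset.erase_insert hsc']
    subst hcc
    have hvw : v = w := by
      by_contra hne
      have : v ∈ s.erase w := Finset.mem_erase.2 ⟨hne, hp.1⟩
      exact Finset.notMem_erase v s (h1 _ h4' this)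
    subst hvw
    rfl
  · intro c hc
    simp only [Finset.mem_filter] at hc
    obtain ⟨hc, hcard⟩ := hc
    obtain ⟨h1, h2, h3, h4, t, ht, htB⟩ := mem_chainsWithTop.1 hc
    have hcard' : (c.erase s).card = s.card - 1 := by rw [Finset.card_erase_of_mem h4, hcard]
    have hne : (c.erase s).Nonempty := Finset.card_pos.1 (by omega)
    have hch : IsChain (· ⊆ ·) ((c.erase s : Finset (Finset V)) : Set (Finset V)) :=
      h3.mono (by simp)
    obtain ⟨m, hm, hmt⟩ := hch.exists_finset_top hne
    -- If the removed top was the member inside B, then the next member m, being a subset of it,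
    -- lies inside B as well.
    have hex : ∃ t ∈ c.erase s, (t : Set V) ⊆ B := by
      by_cases hts : t = s
      · exact ⟨m, hm, (Finset.coe_subset.2 (h1 m (Finset.mem_of_mem_erase hm))).trans (hts ▸ htB)⟩
      · exact ⟨t, Finset.mem_erase.2 ⟨hts, ht⟩, htB⟩
    have hmc : c.erase s ∈ chainsWithTop B m :=
      mem_chainsWithTop.2 ⟨hmt, fun h => h2 (Finset.mem_of_mem_erase h), hch, hm, hex⟩
    have hle := card_le_of_mem_chainsWithTop hmc
    have hms : m ⊂ s := Finset.ssubset_iff_subset_ne.2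
      ⟨h1 m (Finset.mem_of_mem_erase hm), (Finset.mem_erase.1 hm).1⟩
    obtain ⟨v, hv, hmv⟩ := Finset.ssubset_iff_exists_subset_erase.1 hms
    have hmeq : m = s.erase v := by
      refine Finset.eq_of_subset_of_card_le hmv ?_
      rw [Finset.card_erase_of_mem hv, ← hcard']
      exact hle
    subst hmeq
    refine ⟨⟨v, c.erase s⟩, ?_, Finset.insert_erase h4⟩
    simp only [Finset.mem_sigma, Finset.mem_filter]
    exact ⟨hv, hmc, by rw [hcard', Finset.card_erase_of_mem hv]⟩

open Classical in
theorem flagCount_singleton (B : Set V) (v : V) :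
    flagCount B {v} = if v ∈ B then 1 else 0 := by
  have key : ∀ c, c ∈ chainsWithTop B {v} ↔ c = {{v}} ∧ v ∈ B := by
    intro c
    constructor
    · intro hc
      obtain ⟨h1, h2, -, h4, -⟩ := mem_chainsWithTop.1 hc
      obtain ⟨w, hw, hwB⟩ := exists_mem_of_mem_chainsWithTop hc
      rw [Finset.mem_singleton] at hw
      subst hw
      refine ⟨?_, hwB⟩
      refine Finset.eq_singleton_iff_unique_mem.2 ⟨h4, fun t ht => ?_⟩
      rcases Finset.subset_singleton_iff.1 (h1 t ht) with h | h
      · exact absurd (h ▸ ht) h2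
      · exact h
    · rintro ⟨rfl, hv⟩
      simp [mem_chainsWithTop, hv]
  unfold flagCount
  split_ifs with hv
  · rw [Finset.card_eq_one]
    refine ⟨{{v}}, ?_⟩
    ext c
    simp only [Finset.mem_filter, key, Finset.mem_singleton, Finset.card_singleton]
    constructor
    · exact fun h => h.1.1
    · rintro rfl
      simp [hv]
  · rw [Finset.card_eq_zero]
    ext c
    simp [key, hv]

open Classical in
theorem flagCount_of_subset {B : Set V} {s : Finset V} (hs : s.Nonempty) (hB : (s : Set V) ⊆ B) :
    flagCount B s = s.card.factorial := by
  induction s using Finset.strongInduction with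
  | H s ih =>
    by_cases h2 : 2 ≤ s.card
    · rw [flagCount_eq_sum_erase B h2]
      have : ∀ v ∈ s, flagCount B (s.erase v) = (s.card - 1).factorial := by
        intro v hv
        rw [ih _ (Finset.erase_ssubset hv) (Finset.card_pos.1 (by
          rw [Finset.card_erase_of_mem hv]; omega))
          ((Finset.coe_subset.2 (Finset.erase_subset v s)).trans hB), Finset.card_erase_of_mem hv]
      rw [Finset.sum_congr rfl this, Finset.sum_const, smul_eq_mul]
      exact Nat.mul_factorial_pred hs.card_pos.ne'
    · obtain ⟨v, rfl⟩ := Finset.card_eq_one.1 (by have := hs.card_pos; omega : s.card = 1)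
      rw [flagCount_singleton, if_pos (hB (by simp))]
      rfl

open Classical in
theorem flagCount_le (B : Set V) {s : Finset V} (hs : s.Nonempty) :
    flagCount B s ≤ s.card.factorial := by
  rw [← flagCount_of_subset hs (subset_univ _)]
  refine Finset.card_le_card fun c hc => ?_
  rw [Finset.mem_filter, mem_chainsWithTop] at hc ⊢
  obtain ⟨⟨h1, h2, h3, h4, t, ht, -⟩, h5⟩ := hc
  exact ⟨⟨h1, h2, h3, h4, t, ht, subset_univ _⟩, h5⟩

open Classical in
-- A flag whose smallest member is a point g outside B has no member inside B, since g lies in all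
-- of them. In the induction this is reached by deleting only points other than g. This strict
-- inequality is the source of the spectral gap between the two growth rates.
theorem flagCount_lt {B : Set V} {s : Finset V} (hB : ¬ (s : Set V) ⊆ B) :
    flagCount B s < s.card.factorial := by
  induction s using Finset.strongInduction with
  | H s ih =>
    obtain ⟨g, hg, hgB⟩ := Set.not_subset.1 hB
    rw [Finset.mem_coe] at hg
    by_cases h2 : 2 ≤ s.card
    · rw [flagCount_eq_sum_erase B h2]
      have hsum : ∑ v ∈ s, (s.card - 1).factorial = s.card.factorial := by
        rw [Finset.sum_const, smul_eq_mul]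
        exact Nat.mul_factorial_pred (by omega)
      rw [← hsum]
      obtain ⟨v, hv, hvg⟩ := Finset.exists_mem_ne (by omega : 1 < s.card) g
      refine Finset.sum_lt_sum (fun w hw => ?_) ⟨v, hv, ?_⟩
      · rw [← Finset.card_erase_of_mem hw]
        exact flagCount_le B (Finset.card_pos.1 (by rw [Finset.card_erase_of_mem hw]; omega))
      · rw [← Finset.card_erase_of_mem hv]
        exact ih _ (Finset.erase_ssubset hv) fun h =>
          hgB (h (Finset.mem_coe.2 (Finset.mem_erase.2 ⟨hvg.symm, hg⟩)))
    · obtain ⟨v, rfl⟩ := Finset.card_eq_one.1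
        (by have := Finset.card_pos.2 ⟨g, hg⟩; omega : s.card = 1)
      rw [Finset.mem_singleton] at hg
      subst hg
      rw [flagCount_singleton, if_neg hgB]
      simp

/-- Chains with top `s` weighted by a large number `R`: the full flags dominate. -/
theorem sum_chainsWithTop_le {B : Set V} {s : Finset V} {D ε R : ℝ} {k : ℕ} (hk : s.card ≤ k)
    (hD : (flagCount B s : ℝ) ≤ D) (hR : 1 ≤ R) (hε : (2 : ℝ) ^ 2 ^ k ≤ ε * R) :
    ∑ c ∈ chainsWithTop B s, R ^ c.card ≤ (D + ε) * R ^ s.card := by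
  have hR0 : 0 ≤ R := zero_le_one.trans hR
  rw [← Finset.sum_filter_add_sum_filter_not _ (fun c => c.card = s.card), add_mul]
  gcongr ?_ + ?_
  · calc ∑ c ∈ (chainsWithTop B s).filter (fun c => c.card = s.card), R ^ c.card
        = ∑ c ∈ (chainsWithTop B s).filter (fun c => c.card = s.card), R ^ s.card :=
          Finset.sum_congr rfl fun c hc => by rw [(Finset.mem_filter.1 hc).2]
      _ = flagCount B s * R ^ s.card := by rw [Finset.sum_const, nsmul_eq_mul]; rfl
      _ ≤ _ := by gcongr
  · rcases (chainsWithTop B s).eq_empty_or_nonempty with he | ⟨c₀, hc₀⟩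
    · rw [he]
      simp only [Finset.filter_empty, Finset.sum_empty]
      have : 0 ≤ ε * R := le_trans (by positivity) hε
      have : 0 ≤ ε := nonneg_of_mul_nonneg_left this (by linarith)
      positivity
    -- The remaining chains are shorter by at least one, hence lose a factor R, and there are at
    -- most 2^2^k of them; the choice of R absorbs their number into ε.
    have hpos := (nonempty_of_mem_chainsWithTop hc₀).card_pos
    calc ∑ c ∈ (chainsWithTop B s).filter (fun c => ¬ c.card = s.card), R ^ c.card
        ≤ ∑ c ∈ (chainsWithTop B s).filter (fun c => ¬ c.card = s.card), R ^ (s.card - 1) := by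
          refine Finset.sum_le_sum fun c hc => pow_le_pow_right₀ hR ?_
          have h1 := card_le_of_mem_chainsWithTop (Finset.mem_filter.1 hc).1
          have h2 := (Finset.mem_filter.1 hc).2
          omega
      _ ≤ (2 : ℝ) ^ 2 ^ k * R ^ (s.card - 1) := by
          rw [Finset.sum_const, nsmul_eq_mul]
          gcongr
          calc ((((chainsWithTop B s).filter (fun c => ¬ c.card = s.card)).card : ℕ) : ℝ)
              ≤ ((2 ^ 2 ^ s.card : ℕ) : ℝ) := by
                exact_mod_cast (Finset.card_le_card (Finset.filter_subset _ _)).trans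
                  (card_chainsWithTop_le B s)
            _ = (2 : ℝ) ^ 2 ^ s.card := by push_cast; rfl
            _ ≤ (2 : ℝ) ^ 2 ^ k := by
                gcongr
                · norm_num
                · norm_num
      _ ≤ ε * R * R ^ (s.card - 1) := by gcongr
      _ = ε * R ^ s.card := by
          rw [mul_assoc, ← pow_succ', Nat.sub_add_cancel hpos]

end Chains

/-! ### Weighted clique sums under refinement -/

namespace SimpleGraph

variable {V : Type u}

open Classical in
/-- The cliques that meet `B`. -/
noncomputable def cliquesMeeting [Fintype V] (G : SimpleGraph V) (B : Set V) :
    Finset (Finset V) :=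
  Finset.univ.filter fun s => G.IsClique (s : Set V) ∧ ∃ v ∈ s, v ∈ B

theorem mem_cliquesMeeting [Fintype V] {G : SimpleGraph V} {B : Set V} {s : Finset V} :
    s ∈ G.cliquesMeeting B ↔ G.IsClique (s : Set V) ∧ ∃ v ∈ s, v ∈ B := by
  simp [cliquesMeeting]

/-- The sum of `g (#s)` over the cliques `s` that meet `B`. -/
noncomputable def cliqueSum [Fintype V] (G : SimpleGraph V) (B : Set V) (g : ℕ → ℝ) : ℝ :=
  ∑ s ∈ G.cliquesMeeting B, g s.card

/-- The vertices of the refinement that lie inside `B`. -/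
def refineSet (G : SimpleGraph V) (B : Set V) :
    Set {s : Finset V // s.Nonempty ∧ G.IsClique (s : Set V)} :=
  {s | (s.1 : Set V) ⊆ B}

theorem isChain_map_val (G : SimpleGraph V)
    {c : Finset {s : Finset V // s.Nonempty ∧ G.IsClique (s : Set V)}}
    (hc : G.barycentric.IsClique (c : Set _)) :
    IsChain (· ⊆ ·) ((c.map (Function.Embedding.subtype _) : Finset (Finset V)) :
      Set (Finset V)) := by
  intro x hx y hy hxy
  simp only [Finset.coe_map, Function.Embedding.subtype_apply, Set.mem_image,
    Finset.mem_coe] at hx hy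
  obtain ⟨x, hx, rfl⟩ := hx
  obtain ⟨y, hy, rfl⟩ := hy
  exact (hc hx hy fun h => hxy (congrArg _ h)).2

/-- A clique of the refinement has a largest element. -/
theorem exists_top_of_isClique_barycentric (G : SimpleGraph V)
    {c : Finset {s : Finset V // s.Nonempty ∧ G.IsClique (s : Set V)}}
    (hc : G.barycentric.IsClique (c : Set _)) (hne : c.Nonempty) :
    ∃ s ∈ c, ∀ t ∈ c, t.1 ⊆ s.1 := by
  obtain ⟨s, hs, h⟩ := (G.isChain_map_val hc).exists_finset_top (hne.map)
  obtain ⟨s, hsc, rfl⟩ := Finset.mem_map.1 hs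
  exact ⟨s, hsc, fun t ht => h _ (Finset.mem_map_of_mem _ ht)⟩

theorem map_val_mem_chainsWithTop (G : SimpleGraph V) {B : Set V}
    {c : Finset {s : Finset V // s.Nonempty ∧ G.IsClique (s : Set V)}}
    (hc : G.barycentric.IsClique (c : Set _)) {s} (hs : s ∈ c) (hst : ∀ t ∈ c, t.1 ⊆ s.1)
    (hB : ∃ t ∈ c, t ∈ G.refineSet B) :
    c.map (Function.Embedding.subtype _) ∈ chainsWithTop B s.1 := by
  refine mem_chainsWithTop.2 ⟨?_, ?_, G.isChain_map_val hc, Finset.mem_map_of_mem _ hs, ?_⟩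
  · intro t ht
    obtain ⟨t, htc, rfl⟩ := Finset.mem_map.1 ht
    exact hst t htc
  · intro h
    obtain ⟨t, -, ht⟩ := Finset.mem_map.1 h
    exact t.2.1.ne_empty ht
  · obtain ⟨t, ht, htB⟩ := hB
    exact ⟨t.1, Finset.mem_map_of_mem _ ht, htB⟩

/-- The cliques of the refinement are chains of cliques; group them by their top. -/
theorem cliqueSum_barycentric [Fintype V] (G : SimpleGraph V)
    [Fintype {s : Finset V // s.Nonempty ∧ G.IsClique (s : Set V)}] (B : Set V) (g : ℕ → ℝ) :
    G.barycentric.cliqueSum (G.refineSet B) g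
      = ∑ s ∈ G.cliquesMeeting B, ∑ c ∈ chainsWithTop B s, g c.card := by
  classical
  unfold cliqueSum
  rw [Finset.sum_sigma']
  have htop : ∀ c ∈ G.barycentric.cliquesMeeting (G.refineSet B),
      ∃ s ∈ c, ∀ t ∈ c, t.1 ⊆ s.1 := by
    intro c hc
    obtain ⟨h1, v, hv, -⟩ := mem_cliquesMeeting.1 hc
    exact G.exists_top_of_isClique_barycentric h1 ⟨v, hv⟩
  choose top htop1 htop2 using htop
  refine Finset.sum_bij
    (fun c hc => ⟨(top c hc).1, c.map (Function.Embedding.subtype _)⟩) ?_ ?_ ?_ ?_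
  · intro c hc
    obtain ⟨h1, h2⟩ := mem_cliquesMeeting.1 hc
    have h3 := G.map_val_mem_chainsWithTop h1 (htop1 c hc) (htop2 c hc) h2
    exact Finset.mem_sigma.2
      ⟨mem_cliquesMeeting.2 ⟨(top c hc).2.2, exists_mem_of_mem_chainsWithTop h3⟩, h3⟩
  · intro c _ c' _ h
    exact Finset.map_injective _ (eq_of_heq (Sigma.mk.inj h).2)
  · rintro ⟨s, c⟩ hp
    obtain ⟨hs, hc⟩ := Finset.mem_sigma.1 hp
    replace hs := (mem_cliquesMeeting.1 hs).1
    obtain ⟨h1, h2, h3, h4, t, ht, htB⟩ := mem_chainsWithTop.1 hc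
    have hp : ∀ t ∈ c, t.Nonempty ∧ G.IsClique (t : Set V) := fun t ht =>
      ⟨Finset.nonempty_iff_ne_empty.2 fun h => h2 (h ▸ ht),
        hs.subset (Finset.coe_subset.2 (h1 t ht))⟩
    have hmap : (c.subtype fun s : Finset V => s.Nonempty ∧ G.IsClique (s : Set V)).map
        (Function.Embedding.subtype _) = c := Finset.subtype_map_of_mem hp
    have hmem : c.subtype (fun s : Finset V => s.Nonempty ∧ G.IsClique (s : Set V)) ∈
        G.barycentric.cliquesMeeting (G.refineSet B) := by
      refine mem_cliquesMeeting.2 ⟨?_, ⟨t, hp t ht⟩, Finset.mem_subtype.2 ht, htB⟩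
      intro x hx y hy hxy
      exact ⟨hxy, h3.total (Finset.mem_subtype.1 (Finset.mem_coe.1 hx))
        (Finset.mem_subtype.1 (Finset.mem_coe.1 hy))⟩
    refine ⟨_, hmem, ?_⟩
    have e1 : (top _ hmem).1 = s :=
      Finset.Subset.antisymm (h1 _ (Finset.mem_subtype.1 (htop1 _ hmem)))
        (htop2 _ hmem ⟨s, hp s h4⟩ (Finset.mem_subtype.2 h4))
    simp only [hmap, e1]
  · intro c _
    simp

theorem card_le_of_cliqueFree {G : SimpleGraph V} {d : ℕ} (hG : G.CliqueFree (d + 2))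
    {s : Finset V} (hs : G.IsClique (s : Set V)) : s.card ≤ d + 1 := by
  by_contra h
  obtain ⟨t, hts, ht⟩ := Finset.exists_subset_card_eq (not_le.1 h)
  exact hG t ⟨hs.subset (Finset.coe_subset.2 hts), ht⟩

theorem exists_card_le_of_isClique_barycentric (G : SimpleGraph V)
    {c : Finset {s : Finset V // s.Nonempty ∧ G.IsClique (s : Set V)}}
    (hc : G.barycentric.IsClique (c : Set _)) (hne : c.Nonempty) : ∃ s ∈ c, c.card ≤ s.1.card := by
  obtain ⟨s, hs, hst⟩ := G.exists_top_of_isClique_barycentric hc hne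
  have := card_le_of_mem_chainsWithTop (G.map_val_mem_chainsWithTop (B := univ) hc hs hst
    ⟨s, hs, subset_univ _⟩)
  rw [Finset.card_map] at this
  exact ⟨s, hs, this⟩

theorem cliqueFree_barycentric {G : SimpleGraph V} {d : ℕ} (hG : G.CliqueFree (d + 2)) :
    G.barycentric.CliqueFree (d + 2) := by
  intro c hc
  obtain ⟨s, -, hs⟩ := G.exists_card_le_of_isClique_barycentric hc.isClique
    (Finset.card_pos.1 (by rw [hc.card_eq]; omega))
  have := card_le_of_cliqueFree hG s.2.2
  rw [hc.card_eq] at hs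
  omega

/-- A maximal flag of the refinement has a (d+1)-clique of the old graph as its top. Thus the
condition that drives the smaller growth rate reproduces itself. -/
theorem not_subset_refineSet {G : SimpleGraph V} {d : ℕ} (hG : G.CliqueFree (d + 2))
    {B : Set V} (hB : ∀ s : Finset V, G.IsNClique (d + 1) s → ¬ (s : Set V) ⊆ B)
    (c : Finset {s : Finset V // s.Nonempty ∧ G.IsClique (s : Set V)})
    (hc : G.barycentric.IsNClique (d + 1) c) : ¬ (c : Set _) ⊆ G.refineSet B := by
  intro hcB
  obtain ⟨s, hs, hle⟩ := G.exists_card_le_of_isClique_barycentric hc.isClique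
    (Finset.card_pos.1 (by rw [hc.card_eq]; omega))
  rw [hc.card_eq] at hle
  exact hB s.1 ⟨s.2.2, le_antisymm (card_le_of_cliqueFree hG s.2.2) hle⟩ (hcB hs)

theorem cliqueSum_nonneg [Fintype V] (G : SimpleGraph V) (B : Set V) {g : ℕ → ℝ}
    (hg : ∀ k, 0 ≤ g k) : 0 ≤ G.cliqueSum B g :=
  Finset.sum_nonneg fun _ _ => hg _

/-- One step of the growth estimate: the chains over each clique contribute at most D + ε times its
weight. With B everything, D is (d+1)!; with B an exceptional set it is (d+1)! - 1. -/
theorem cliqueSum_barycentric_le [Fintype V] {G : SimpleGraph V}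
    [Fintype {s : Finset V // s.Nonempty ∧ G.IsClique (s : Set V)}] {d : ℕ}
    (hG : G.CliqueFree (d + 2)) {B : Set V} {D ε R : ℝ}
    (hD : ∀ s : Finset V, s.Nonempty → G.IsClique (s : Set V) → (flagCount B s : ℝ) ≤ D)
    (hR : 1 ≤ R) (hε : (2 : ℝ) ^ 2 ^ (d + 1) ≤ ε * R) :
    G.barycentric.cliqueSum (G.refineSet B) (R ^ ·) ≤ (D + ε) * G.cliqueSum B (R ^ ·) := by
  rw [cliqueSum_barycentric, cliqueSum, Finset.mul_sum]
  refine Finset.sum_le_sum fun s hs => ?_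
  obtain ⟨h1, v, hv, -⟩ := mem_cliquesMeeting.1 hs
  exact sum_chainsWithTop_le (card_le_of_cliqueFree hG h1) (hD s ⟨v, hv⟩ h1) hR hε

theorem flagCount_le_of_cliqueFree {G : SimpleGraph V} {d : ℕ} (hG : G.CliqueFree (d + 2))
    (B : Set V) (s : Finset V) (hne : s.Nonempty) (hs : G.IsClique (s : Set V)) :
    (flagCount B s : ℝ) ≤ (d + 1).factorial := by
  exact_mod_cast (flagCount_le B hne).trans (Nat.factorial_le (card_le_of_cliqueFree hG hs))

/-- Smaller cliques have fewer than (d+1)! full flags in any case; those with d+1 vertices lose one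
because they are not inside B. -/
theorem flagCount_le_of_not_subset {G : SimpleGraph V} {d : ℕ} (hG : G.CliqueFree (d + 2))
    {B : Set V} (hB : ∀ s : Finset V, G.IsNClique (d + 1) s → ¬ (s : Set V) ⊆ B)
    (s : Finset V) (hne : s.Nonempty) (hs : G.IsClique (s : Set V)) :
    (flagCount B s : ℝ) ≤ (d + 1).factorial - 1 := by
  rw [le_sub_iff_add_le]
  norm_cast
  rw [Nat.add_one_le_iff]
  rcases (card_le_of_cliqueFree hG hs).lt_or_eq with h | h
  · exact (flagCount_le B hne).trans_lt ((Nat.factorial_lt hne.card_pos).2 h)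
  · rw [← h]
    exact flagCount_lt (hB s ⟨hs, h⟩)

theorem refineSet_univ (G : SimpleGraph V) : G.refineSet univ = univ := by
  ext
  simp [refineSet]

/-- Every `(d+1)`-clique is subdivided into at least `(d+1)!` many. -/
theorem factorial_mul_cliqueSum_le [Fintype V] (G : SimpleGraph V)
    [Fintype {s : Finset V // s.Nonempty ∧ G.IsClique (s : Set V)}] (d : ℕ) :
    (d + 1).factorial * G.cliqueSum univ (Pi.single (d + 1) 1)
      ≤ G.barycentric.cliqueSum univ (Pi.single (d + 1) 1) := by
  have hnn : ∀ k, (0 : ℝ) ≤ (Pi.single (d + 1) 1 : ℕ → ℝ) k := fun k => by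
    rw [Pi.single_apply]
    split_ifs <;> norm_num
  rw [← G.refineSet_univ, cliqueSum_barycentric, cliqueSum, Finset.mul_sum]
  refine Finset.sum_le_sum fun s hs => ?_
  obtain ⟨h1, v, hv, -⟩ := mem_cliquesMeeting.1 hs
  by_cases hcard : s.card = d + 1
  · refine le_of_eq ?_
    calc ((d + 1).factorial : ℝ) * (Pi.single (d + 1) 1 : ℕ → ℝ) s.card
        = flagCount univ s := by
          rw [hcard, Pi.single_eq_same, mul_one, flagCount_of_subset ⟨v, hv⟩ (subset_univ _),
            hcard]
      _ = ∑ c ∈ chainsWithTop univ s, (Pi.single (d + 1) 1 : ℕ → ℝ) c.card := by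
          rw [flagCount, Finset.card_filter]
          push_cast
          refine Finset.sum_congr rfl fun c _ => ?_
          rw [Pi.single_apply, hcard]
  · rw [Pi.single_eq_of_ne hcard, mul_zero]
    exact Finset.sum_nonneg fun _ _ => hnn _

end SimpleGraph

/-! ### Deleting the edges at an exceptional set -/

namespace SimpleGraph

/-- The spanning subgraph of the edges with no end in `B`. -/
def awayFrom {V : Type u} (G : SimpleGraph V) (B : Set V) : SimpleGraph V where
  Adj v w := G.Adj v w ∧ v ∉ B ∧ w ∉ B
  symm := ⟨fun _ _ h => ⟨h.1.symm, h.2.2, h.2.1⟩⟩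
  loopless := ⟨fun v h => G.loopless.irrefl v h.1⟩

theorem awayFrom_le {V : Type u} (G : SimpleGraph V) (B : Set V) : G.awayFrom B ≤ G := fun _ _ h => h.1

section Counting

variable {V : Type u} [Fintype V]

open Classical in
theorem card_le_cliqueSum (G : SimpleGraph V) (B : Set V) {R : ℝ} (hR : 1 ≤ R) :
    (Fintype.card B : ℝ) ≤ G.cliqueSum B (R ^ ·) := by
  have h1 : Fintype.card B ≤ (G.cliquesMeeting B).card := by
    rw [← Finset.card_univ]
    refine Finset.card_le_card_of_injOn (fun v => {v.1}) (fun v _ => ?_) fun v _ w _ h =>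
      Subtype.ext (Finset.singleton_injective h)
    exact Finset.mem_coe.2 (mem_cliquesMeeting.2 ⟨by simp, v.1, by simp, v.2⟩)
  calc (Fintype.card B : ℝ) ≤ (G.cliquesMeeting B).card := by exact_mod_cast h1
    _ = ∑ s ∈ G.cliquesMeeting B, (1 : ℝ) := by simp
    _ ≤ _ := Finset.sum_le_sum fun s _ => one_le_pow₀ hR

theorem cliqueSum_single_le_card (G : SimpleGraph V)
    [Fintype {s : Finset V // s.Nonempty ∧ G.IsClique (s : Set V)}] (k : ℕ) :
    G.cliqueSum univ (Pi.single k 1)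
      ≤ Fintype.card {s : Finset V // s.Nonempty ∧ G.IsClique (s : Set V)} := by
  classical
  have h1 : (G.cliquesMeeting univ).card
      ≤ Fintype.card {s : Finset V // s.Nonempty ∧ G.IsClique (s : Set V)} := by
    rw [Fintype.card_subtype]
    refine Finset.card_le_card fun s hs => ?_
    obtain ⟨h, v, hv, -⟩ := mem_cliquesMeeting.1 hs
    exact Finset.mem_filter.2 ⟨Finset.mem_univ _, ⟨v, hv⟩, h⟩
  calc G.cliqueSum univ (Pi.single k 1) ≤ ∑ s ∈ G.cliquesMeeting univ, (1 : ℝ) := by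
        refine Finset.sum_le_sum fun s _ => ?_
        rw [Pi.single_apply]
        split_ifs <;> norm_num
    _ = (G.cliquesMeeting univ).card := by simp
    _ ≤ _ := by exact_mod_cast h1

theorem one_le_cliqueSum_single {G : SimpleGraph V} {k : ℕ} {s : Finset V}
    (hs : G.IsNClique (k + 1) s) : 1 ≤ G.cliqueSum univ (Pi.single (k + 1) 1) := by
  obtain ⟨v, hv⟩ := Finset.card_pos.1 (by rw [hs.card_eq]; omega : 0 < s.card)
  have hmem : s ∈ G.cliquesMeeting univ := mem_cliquesMeeting.2 ⟨hs.isClique, v, hv, mem_univ v⟩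
  refine le_trans ?_ (Finset.single_le_sum (f := fun s : Finset V =>
    (Pi.single (k + 1) 1 : ℕ → ℝ) s.card) (fun t _ => ?_) hmem)
  · simp [hs.card_eq]
  · rw [Pi.single_apply]
    split_ifs <;> norm_num

open Classical in
-- A deleted edge is a 2-clique meeting B, distinct edges give distinct cliques, and each clique has
-- weight at least 1. The factor 2 counts the ends of an edge.
theorem sum_degree_le (G : SimpleGraph V) (B : Set V) {R : ℝ} (hR : 1 ≤ R) :
    ((∑ v, G.degree v : ℕ) : ℝ)
      ≤ ((∑ v, (G.awayFrom B).degree v : ℕ) : ℝ) + 2 * G.cliqueSum B (R ^ ·) := by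
  have h1 : (G.edgeFinset \ (G.awayFrom B).edgeFinset).card ≤ (G.cliquesMeeting B).card := by
    refine Finset.card_le_card_of_injOn (fun e => Finset.univ.filter (· ∈ e)) (fun e he => ?_)
      fun e _ e' _ h => Sym2.ext fun v => ?_
    · induction e with
      | h v w =>
        rw [Finset.mem_coe, Finset.mem_sdiff, mem_edgeFinset, mem_edgeFinset, mem_edgeSet,
          mem_edgeSet] at he
        obtain ⟨h1, h2⟩ := he
        refine Finset.mem_coe.2 (mem_cliquesMeeting.2 ⟨?_, ?_⟩)
        · intro x hx y hy hxy
          simp only [Finset.coe_filter, Finset.mem_univ, true_and, Sym2.mem_iff,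
            mem_ofPred_eq] at hx hy
          rcases hx with rfl | rfl <;> rcases hy with rfl | rfl
          · exact absurd rfl hxy
          · exact h1
          · exact h1.symm
          · exact absurd rfl hxy
        · by_contra hcon
          push Not at hcon
          exact h2 ⟨h1, hcon v (by simp), hcon w (by simp)⟩
    · simpa using congrArg (v ∈ ·) h
  have h2 : G.edgeFinset.card
      ≤ (G.awayFrom B).edgeFinset.card + (G.cliquesMeeting B).card := by
    have := Finset.card_le_card_sdiff_add_card (s := G.edgeFinset)
      (t := (G.awayFrom B).edgeFinset)
    omega
  have h3 : ((G.cliquesMeeting B).card : ℝ) ≤ G.cliqueSum B (R ^ ·) := by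
    calc ((G.cliquesMeeting B).card : ℝ) = ∑ s ∈ G.cliquesMeeting B, (1 : ℝ) := by simp
      _ ≤ _ := Finset.sum_le_sum fun s _ => one_le_pow₀ hR
  have h2' : (G.edgeFinset.card : ℝ)
      ≤ (G.awayFrom B).edgeFinset.card + (G.cliquesMeeting B).card := by exact_mod_cast h2
  rw [sum_degrees_eq_twice_card_edges, sum_degrees_eq_twice_card_edges]
  push_cast
  linarith

open Classical in
theorem sum_degree_le_cliqueSum_univ (G : SimpleGraph V) {R : ℝ} (hR : 1 ≤ R) :
    ((∑ v, G.degree v : ℕ) : ℝ) ≤ 2 * G.cliqueSum univ (R ^ ·) := by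
  have h := G.sum_degree_le univ hR
  have h0 : ∀ v, (G.awayFrom univ).degree v = 0 := fun v => by
    rw [← card_neighborFinset_eq_degree, Finset.card_eq_zero]
    ext w
    rw [mem_neighborFinset]
    exact iff_of_false (fun h => h.2.1 (mem_univ v)) (Finset.notMem_empty w)
  simpa [h0] using h

end Counting

/-! ### Graphs patched from copies of one graph -/

section Patches

variable {ι V W : Type u}

/-- The map of barycentric refinements that is induced by an embedding of graphs. -/
def Embedding.barycentric {H : SimpleGraph W} {G : SimpleGraph V} (φ : H ↪g G) :
    H.barycentric ↪g G.barycentric where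
  toFun s := ⟨s.1.map φ.toEmbedding, s.2.1.map, by
    intro x hx y hy hxy
    obtain ⟨x, hx', rfl⟩ := Finset.mem_map.1 (Finset.mem_coe.1 hx)
    obtain ⟨y, hy', rfl⟩ := Finset.mem_map.1 (Finset.mem_coe.1 hy)
    exact φ.map_adj_iff.2 (s.2.2 hx' hy' fun h => hxy (congrArg _ h))⟩
  inj' s t h := Subtype.ext (Finset.map_injective _ (congrArg Subtype.val h))
  map_rel_iff' {s t} := by
    change (_ ≠ _ ∧ (s.1.map φ.toEmbedding ⊆ t.1.map φ.toEmbedding ∨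
      t.1.map φ.toEmbedding ⊆ s.1.map φ.toEmbedding)) ↔ s ≠ t ∧ (s.1 ⊆ t.1 ∨ t.1 ⊆ s.1)
    rw [Finset.map_subset_map, Finset.map_subset_map]
    refine and_congr_left fun _ => not_congr ⟨fun h => ?_, fun h => h ▸ rfl⟩
    exact Subtype.ext (Finset.map_injective _ (congrArg Subtype.val h))

theorem Embedding.barycentric_val {H : SimpleGraph W} {G : SimpleGraph V} (φ : H ↪g G)
    (s : {s : Finset W // s.Nonempty ∧ H.IsClique (s : Set W)}) :
    (φ.barycentric s).1 = s.1.map φ.toEmbedding := rfl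

theorem Embedding.mem_barycentric {H : SimpleGraph W} {G : SimpleGraph V} (φ : H ↪g G)
    {s : {s : Finset W // s.Nonempty ∧ H.IsClique (s : Set W)}} {v : V} :
    v ∈ (φ.barycentric s).1 ↔ ∃ w ∈ s.1, φ w = v :=
  Finset.mem_map

theorem Embedding.mem_range_barycentric {H : SimpleGraph W} {G : SimpleGraph V} (φ : H ↪g G)
    (s : {s : Finset V // s.Nonempty ∧ G.IsClique (s : Set V)}) :
    s ∈ range φ.barycentric ↔ ∀ v ∈ s.1, v ∈ range φ := by
  classical
  constructor
  · rintro ⟨t, rfl⟩ v hv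
    obtain ⟨w, -, rfl⟩ := φ.mem_barycentric.1 hv
    exact mem_range_self w
  · intro h
    have hmap : (s.1.preimage φ φ.injective.injOn).map φ.toEmbedding = s.1 := by
      ext v
      simp only [Finset.mem_map, Finset.mem_preimage]
      constructor
      · rintro ⟨w, hw, rfl⟩
        exact hw
      · intro hv
        obtain ⟨w, rfl⟩ := h v hv
        exact ⟨w, hv, rfl⟩
    refine ⟨⟨s.1.preimage φ φ.injective.injOn, ?_, ?_⟩, Subtype.ext hmap⟩
    · obtain ⟨v, hv⟩ := s.2.1
      obtain ⟨w, rfl⟩ := h v hv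
      exact ⟨w, Finset.mem_preimage.2 hv⟩
    · intro x hx y hy hxy
      rw [Finset.mem_coe, Finset.mem_preimage] at hx hy
      exact φ.map_adj_iff.1 (s.2.2 hx hy (φ.injective.ne hxy))

/-- A family of embeddings of `H` into `G` such that the vertices of `G` outside `B` are the images
of the vertices of `H` outside `C`, and these are interior to their copy and lie in no other. -/
structure PatchFamily {H : SimpleGraph W} {G : SimpleGraph V} (φ : ι → (H ↪g G)) (C : Set W)
    (B : Set V) : Prop where
  mem_range_of_adj : ∀ i w v, w ∉ C → G.Adj (φ i w) v → v ∈ range (φ i)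
  notMem_range : ∀ i j w, i ≠ j → w ∉ C → φ i w ∉ range (φ j)
  notMem_iff : ∀ v, v ∉ B ↔ ∃ i w, w ∉ C ∧ φ i w = v

namespace PatchFamily

variable {H : SimpleGraph W} {G : SimpleGraph V} {φ : ι → (H ↪g G)} {C : Set W} {B : Set V}

theorem barycentric (h : PatchFamily φ C B) :
    PatchFamily (fun i => (φ i).barycentric) (H.refineSet C) (G.refineSet B) := by
  -- All vertices of a simplex containing an interior point of a copy equal or neighbour that point,
  -- so the whole simplex lies in the copy. A nonexceptional vertex of the refinement is such a
  -- simplex, and its neighbours in the refinement also lie in the copy.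
  have key : ∀ i (w : W) (s : {s : Finset V // s.Nonempty ∧ G.IsClique (s : Set V)}),
      w ∉ C → φ i w ∈ s.1 → s ∈ range (φ i).barycentric := by
    intro i w s hw hs
    refine ((φ i).mem_range_barycentric s).2 fun v hv => ?_
    by_cases hv' : φ i w = v
    · exact ⟨w, hv'⟩
    · exact h.mem_range_of_adj i w v hw (s.2.2 hs hv hv')
  refine ⟨?_, ?_, ?_⟩
  · intro i s t hs hst
    obtain ⟨w, hw, hwC⟩ := Set.not_subset.1 hs
    rcases hst.2 with h' | h'
    · exact key i w t hwC (h' ((φ i).mem_barycentric.2 ⟨w, hw, rfl⟩))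
    · refine ((φ i).mem_range_barycentric t).2 fun v hv => ?_
      obtain ⟨w, -, rfl⟩ := (φ i).mem_barycentric.1 (h' hv)
      exact mem_range_self w
  · rintro i j s hij hs ⟨t, ht⟩
    obtain ⟨w, hw, hwC⟩ := Set.not_subset.1 hs
    have : φ i w ∈ ((φ j).barycentric t).1 := by
      rw [ht]
      exact (φ i).mem_barycentric.2 ⟨w, hw, rfl⟩
    obtain ⟨x, -, hx⟩ := (φ j).mem_barycentric.1 this
    exact h.notMem_range i j w hij hwC ⟨x, hx⟩
  · intro s
    constructor
    · intro hs
      obtain ⟨v, hv, hvB⟩ := Set.not_subset.1 hs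
      obtain ⟨i, w, hw, rfl⟩ := (h.notMem_iff v).1 hvB
      obtain ⟨t, rfl⟩ := key i w s hw hv
      obtain ⟨x, hx, hxw⟩ := (φ i).mem_barycentric.1 hv
      rw [(φ i).injective hxw] at hx
      exact ⟨i, t, fun ht => hw (ht hx), rfl⟩
    · rintro ⟨i, t, ht, rfl⟩ hB
      obtain ⟨w, hw, hwC⟩ := Set.not_subset.1 ht
      exact (h.notMem_iff (φ i w)).2 ⟨i, w, hwC, rfl⟩
        (hB ((φ i).mem_barycentric.2 ⟨w, hw, rfl⟩))

/-- The vertices outside `B`, counted by the copies. -/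
noncomputable def equiv (h : PatchFamily φ C B) : {w // w ∉ C} × ι ≃ {v // v ∉ B} :=
  Equiv.ofBijective
    (fun p => ⟨φ p.2 p.1.1, (h.notMem_iff _).2 ⟨p.2, p.1.1, p.1.2, rfl⟩⟩) <| by
    constructor
    · rintro ⟨⟨w, hw⟩, i⟩ ⟨⟨x, hx⟩, j⟩ hp
      have hp' : φ i w = φ j x := congrArg Subtype.val hp
      have hij : i = j := by
        by_contra hij
        exact h.notMem_range i j w hij hw ⟨x, hp'.symm⟩
      subst hij
      have := (φ i).injective hp'
      subst this
      rfl
    · rintro ⟨v, hv⟩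
      obtain ⟨i, w, hw, rfl⟩ := (h.notMem_iff v).1 hv
      exact ⟨⟨⟨w, hw⟩, i⟩, rfl⟩

/-- An edge between points outside B stays within a single copy, so after the deletion the copies no
longer interact. -/
theorem eigenvalueCount_awayFrom_aux [Fintype ι] [Fintype V] [Fintype W]
    [Fintype {w | w ∉ C}] (h : PatchFamily φ C B) {t : ℝ} (ht : 0 ≤ t) :
    (G.awayFrom B).eigenvalueCount t
      = Fintype.card ι * (H.induce {w | w ∉ C}).eigenvalueCount t := by
  refine eigenvalueCount_copies (G.awayFrom B) (H.induce {w | w ∉ C})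
    (h.equiv.toEmbedding.trans (Function.Embedding.subtype _)) (fun v v' => ?_) ht
  constructor
  · rintro ⟨hadj, hv, hv'⟩
    obtain ⟨i, w, hw, rfl⟩ := (h.notMem_iff v).1 hv
    obtain ⟨j, w', hw', rfl⟩ := (h.notMem_iff v').1 hv'
    have hij : j = i := by
      by_contra hji
      exact h.notMem_range j i w' hji hw' (h.mem_range_of_adj i w _ hw hadj)
    subst hij
    exact ⟨j, ⟨w, hw⟩, ⟨w', hw'⟩, (φ j).map_adj_iff.1 hadj, rfl, rfl⟩
  · rintro ⟨i, a, b, hab, rfl, rfl⟩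
    exact ⟨(φ i).map_adj_iff.2 hab, (h.equiv (a, i)).2, (h.equiv (b, i)).2⟩

/-- The trivial patching expresses the induced graph through `awayFrom`, so that both sides of the
next count are spanning subgraphs. -/
theorem refl (H : SimpleGraph W) (C : Set W) :
    PatchFamily (fun _ : PUnit.{u + 1} => (Embedding.refl : H ↪g H)) C C where
  mem_range_of_adj _ _ v _ _ := ⟨v, rfl⟩
  notMem_range i j w hij _ := absurd (Subsingleton.elim i j) hij
  notMem_iff v := ⟨fun h => ⟨⟨⟩, v, h, rfl⟩, by rintro ⟨-, w, hw, rfl⟩; exact hw⟩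

theorem eigenvalueCount_awayFrom [Fintype ι] [Fintype V] [Fintype W]
    (h : PatchFamily φ C B) {t : ℝ} (ht : 0 ≤ t) :
    (G.awayFrom B).eigenvalueCount t
      = Fintype.card ι * (H.awayFrom C).eigenvalueCount t := by
  let _ : Fintype {w | w ∉ C} := Fintype.ofFinite _
  rw [h.eigenvalueCount_awayFrom_aux ht, (refl H C).eigenvalueCount_awayFrom_aux ht]
  simp

open Classical in
-- Both sides are |V| - |B| = N(|W| - |C|), rearranged to avoid subtraction.
theorem card_add_eq [Fintype ι] [Fintype V] [Fintype W] (h : PatchFamily φ C B) :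
    Fintype.card V + Fintype.card ι * Fintype.card C
      = Fintype.card ι * Fintype.card W + Fintype.card B := by
  have h1 := Fintype.card_congr h.equiv
  rw [Fintype.card_prod] at h1
  have h2 := Fintype.card_subtype_compl (· ∈ C)
  have h3 := Fintype.card_subtype_compl (· ∈ B)
  have h4 : Fintype.card C ≤ Fintype.card W := Fintype.card_subtype_le (· ∈ C)
  have h5 : Fintype.card B ≤ Fintype.card V := Fintype.card_subtype_le (· ∈ B)
  have h6 : Fintype.card {w // w ∉ C} + Fintype.card C = Fintype.card W := by
    rw [h2]; exact Nat.sub_add_cancel h4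
  have h7 : Fintype.card {v // v ∉ B} + Fintype.card B = Fintype.card V := by
    rw [h3]; exact Nat.sub_add_cancel h5
  rw [← h6, ← h7, ← h1]
  ring

end PatchFamily

/-- The simplices that are not of top dimension `d`. -/
def lowerSimplices (G : SimpleGraph V) (d : ℕ) :
    Set {s : Finset V // s.Nonempty ∧ G.IsClique (s : Set V)} :=
  {s | s.1.card ≤ d}

theorem not_subset_lowerSimplices (G : SimpleGraph V) {d : ℕ}
    (c : Finset {s : Finset V // s.Nonempty ∧ G.IsClique (s : Set V)})
    (hc : G.barycentric.IsNClique (d + 1) c) : ¬ (c : Set _) ⊆ G.lowerSimplices d := by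
  intro hcB
  obtain ⟨s, hs, hle⟩ := G.exists_card_le_of_isClique_barycentric hc.isClique
    (Finset.card_pos.1 (by rw [hc.card_eq]; omega))
  have h : s.1.card ≤ d := hcB hs
  rw [hc.card_eq] at hle
  omega

theorem exists_embedding_of_isNClique [Fintype W] {G : SimpleGraph V} {s : Finset V}
    (hs : G.IsNClique (Fintype.card W) s) :
    ∃ φ : (⊤ : SimpleGraph W) ↪g G, range φ = s := by
  let e : W ≃ s := Fintype.equivOfCardEq (by rw [Fintype.card_coe, hs.card_eq])
  refine ⟨⟨e.toEmbedding.trans (Function.Embedding.subtype _), ?_⟩, ?_⟩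
  · intro x y
    constructor
    · intro h
      rw [top_adj]
      rintro rfl
      exact h.ne rfl
    · intro h
      exact hs.isClique (e x).2 (e y).2 fun h' => h (e.injective (Subtype.ext h'))
  · ext v
    constructor
    · rintro ⟨w, rfl⟩
      exact (e w).2
    · intro hv
      exact ⟨e.symm ⟨v, hv⟩, by simp⟩

/-- After one refinement, a graph of clique number `d + 1` is covered up to lower simplices by
refined `d`-simplices. -/
theorem exists_patchFamily [Fintype W] {d : ℕ} (hW : Fintype.card W = d + 1) {G : SimpleGraph V}
    (hG : G.CliqueFree (d + 2)) :
    ∃ φ : {s : Finset V // G.IsNClique (d + 1) s} →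
        ((⊤ : SimpleGraph W).barycentric ↪g G.barycentric),
      PatchFamily φ (lowerSimplices ⊤ d) (G.lowerSimplices d) := by
  have hex : ∀ s : {s : Finset V // G.IsNClique (d + 1) s},
      ∃ φ : (⊤ : SimpleGraph W) ↪g G, range φ = s.1 := fun s =>
    exists_embedding_of_isNClique (by rw [hW]; exact s.2)
  choose φ hφ using hex
  -- The only simplex of the model that is not lower is the full one, so its image is the whole
  -- clique that indexes the copy.
  have hval : ∀ i (s : {s : Finset W // s.Nonempty ∧ (⊤ : SimpleGraph W).IsClique (s : Set W)}),
      s ∉ lowerSimplices ⊤ d → ((φ i).barycentric s).1 = i.1 := by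
    intro i s hs
    have hs' : d < s.1.card := not_le.1 hs
    refine Finset.eq_of_subset_of_card_le (fun v hv => ?_) ?_
    · obtain ⟨w, -, rfl⟩ := (φ i).mem_barycentric.1 hv
      rw [← Finset.mem_coe, ← hφ i]
      exact mem_range_self w
    · rw [i.2.card_eq, Embedding.barycentric_val, Finset.card_map]
      exact hs'
  have hrange : ∀ i (s : {s : Finset V // s.Nonempty ∧ G.IsClique (s : Set V)}),
      s ∈ range (φ i).barycentric ↔ s.1 ⊆ i.1 := by
    intro i s
    rw [(φ i).mem_range_barycentric]
    refine forall₂_congr fun v _ => ?_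
    rw [hφ, Finset.mem_coe]
  refine ⟨fun i => (φ i).barycentric, ?_, ?_, ?_⟩
  · intro i s t hs hst
    refine (hrange i t).2 ?_
    rw [← hval i s hs]
    rcases hst.2 with h | h
    -- No clique is strictly larger than a (d+1)-clique, so a neighbour from above is impossible and
    -- the others lie within the copy.
    · refine (Finset.eq_of_subset_of_card_le h ?_).ge
      rw [hval i s hs, i.2.card_eq]
      exact card_le_of_cliqueFree hG t.2.2
    · exact h
  · intro i j s hij hs hr
    have := (hrange j _).1 hr
    rw [hval i s hs] at this
    exact hij (Subtype.ext (Finset.eq_of_subset_of_card_le this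
      (by rw [i.2.card_eq, j.2.card_eq])))
  · intro s
    constructor
    · intro hs
      have hs' : s.1.card = d + 1 :=
        
        le_antisymm (card_le_of_cliqueFree hG s.2.2) (Nat.lt_of_not_le hs)
      obtain ⟨t, ht⟩ := (hrange ⟨s.1, s.2.2, hs'⟩ s).2 (Finset.Subset.refl _)
      refine ⟨⟨s.1, s.2.2, hs'⟩, t, fun hc => ?_, ht⟩
      have := congrArg (fun s => s.1.card) ht
      simp only [Embedding.barycentric_val, Finset.card_map] at this
      have hc' : t.1.card ≤ d := hc
      omega
    · rintro ⟨i, t, ht, rfl⟩ hB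
      have hB' : ((φ i).barycentric t).1.card ≤ d := hB
      rw [hval i t ht, i.2.card_eq] at hB'
      omega

end Patches

end SimpleGraph

/-! ### Spectral comparison of a graph with its patches -/

namespace SimpleGraph

variable {V : Type u} [Fintype V]

theorem integrableOn_eigenvalueCount (G : SimpleGraph V) :
    IntegrableOn (fun t => (G.eigenvalueCount t : ℝ)) (Ioi 0) := by
  classical
  have hm : Measurable fun t => (G.eigenvalueCount t : ℝ) :=
    measurable_from_top.comp G.measurable_eigenvalueCount
  refine ⟨hm.aestronglyMeasurable, ?_⟩
  have : ∀ t, ‖(G.eigenvalueCount t : ℝ)‖ₑ = (G.eigenvalueCount t : ENNReal) := fun t => by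
    rw [Real.enorm_natCast]
  rw [HasFiniteIntegral]
  simp_rw [this]
  rw [G.lintegral_eigenvalueCount]
  exact ENNReal.natCast_lt_top _

open Classical in
theorem integral_eigenvalueCount (G : SimpleGraph V) :
    ∫ t in Ioi (0 : ℝ), (G.eigenvalueCount t : ℝ) = ((∑ v, G.degree v : ℕ) : ℝ) := by
  rw [integral_eq_lintegral_of_nonneg_ae (Eventually.of_forall fun t => Nat.cast_nonneg _)
    G.integrableOn_eigenvalueCount.aestronglyMeasurable]
  simp_rw [ENNReal.ofReal_natCast]
  rw [G.lintegral_eigenvalueCount, ENNReal.toReal_natCast]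

/-- The integral of a counting function is the trace of the Laplacian, so the difference measures
the deleted edges. -/
theorem integral_eigenvalueCount_sub_le (G : SimpleGraph V) (B : Set V) {R : ℝ} (hR : 1 ≤ R) :
    ∫ t in Ioi (0 : ℝ), ((G.eigenvalueCount t : ℝ) - (G.awayFrom B).eigenvalueCount t)
      ≤ 2 * G.cliqueSum B (R ^ ·) := by
  classical
  rw [integral_sub G.integrableOn_eigenvalueCount (G.awayFrom B).integrableOn_eigenvalueCount,
    integral_eigenvalueCount, integral_eigenvalueCount]
  have := G.sum_degree_le B hR
  linarith

end SimpleGraph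

namespace FinGraph

open SimpleGraph

/-- The spectral functions of a graph and of the graph by which it is patched differ little if the
exceptional sets are small. -/
theorem eLpNorm_spectralFunction_sub_le_of_patchFamily {G H : FinGraph.{u}} (hG : 0 < G.order)
    (hH : 0 < H.order) {ι : Type u} [Fintype ι] {φ : ι → (H.graph ↪g G.graph)} {C : Set H.V}
    {B : Set G.V} (h : PatchFamily φ C B) {R : ℝ} (hR : 1 ≤ R) :
    eLpNorm (fun x => G.spectralFunction x - H.spectralFunction x) 1
        (volume.restrict (Icc (0 : ℝ) 1))
      ≤ ENNReal.ofReal (2 * (G.graph.cliqueSum B (R ^ ·)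
          + Fintype.card ι * H.graph.cliqueSum C (R ^ ·))
        * (1 / G.order + H.graph.cliqueSum univ (R ^ ·) / (G.order * H.order))) := by
  classical
  have hG' : (0 : ℝ) < G.order := by exact_mod_cast hG
  have hH' : (0 : ℝ) < H.order := by exact_mod_cast hH
  set a := G.graph.cliqueSum B (R ^ ·)
  set b := H.graph.cliqueSum C (R ^ ·)
  set E := H.graph.cliqueSum univ (R ^ ·)
  set N : ℝ := (Fintype.card ι : ℝ)
  have hN : 0 ≤ N := Nat.cast_nonneg _
  have hcard : |N * H.order - G.order| ≤ a + N * b := by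
    have h1 : (G.order : ℝ) + N * Fintype.card C = N * H.order + Fintype.card B := by
      have := congrArg (Nat.cast (R := ℝ)) h.card_add_eq
      push_cast at this
      exact this
    have h2 := G.graph.card_le_cliqueSum B hR
    have h3 := mul_le_mul_of_nonneg_left (H.graph.card_le_cliqueSum C hR) hN
    have h4 : 0 ≤ N * Fintype.card C := by positivity
    have h5 : (0 : ℝ) ≤ Fintype.card B := by positivity
    have h2' : (Fintype.card B : ℝ) ≤ a := h2
    have h3' : N * Fintype.card C ≤ N * b := h3
    rw [abs_le]
    constructor <;> linarith
  let g : ℝ → ℝ := fun t =>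
    ((G.graph.eigenvalueCount t : ℝ) - (G.graph.awayFrom B).eigenvalueCount t) / G.order
      + N * ((H.graph.eigenvalueCount t : ℝ) - (H.graph.awayFrom C).eigenvalueCount t) / G.order
      + (a + N * b) / (G.order * H.order) * H.graph.eigenvalueCount t
  have hi1 : IntegrableOn (fun t => (G.graph.eigenvalueCount t : ℝ)
      - (G.graph.awayFrom B).eigenvalueCount t) (Ioi 0) := G.graph.integrableOn_eigenvalueCount.sub
    (G.graph.awayFrom B).integrableOn_eigenvalueCount
  have hi2 : IntegrableOn (fun t => (H.graph.eigenvalueCount t : ℝ)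
      - (H.graph.awayFrom C).eigenvalueCount t) (Ioi 0) := H.graph.integrableOn_eigenvalueCount.sub
    (H.graph.awayFrom C).integrableOn_eigenvalueCount
  have hi1' := hi1.div_const (G.order : ℝ)
  have hi2' := (hi2.const_mul N).div_const (G.order : ℝ)
  have hi3' := H.graph.integrableOn_eigenvalueCount.const_mul ((a + N * b) / (G.order * H.order))
  have hg : IntegrableOn g (Ioi 0) := (hi1'.add hi2').add hi3'
  have hpt : ∀ t ∈ Ioi (0 : ℝ), |(G.graph.eigenvalueCount t : ℝ) / G.order
      - (H.graph.eigenvalueCount t : ℝ) / H.order| ≤ g t := by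
    intro t ht
    have hc : ((G.graph.awayFrom B).eigenvalueCount t : ℝ)
        = N * (H.graph.awayFrom C).eigenvalueCount t := by
      have := congrArg (Nat.cast (R := ℝ)) (h.eigenvalueCount_awayFrom (le_of_lt ht))
      push_cast at this
      exact this
    have hm1 : ((G.graph.awayFrom B).eigenvalueCount t : ℝ) ≤ G.graph.eigenvalueCount t := by
      exact_mod_cast eigenvalueCount_mono (G.graph.awayFrom_le B) t
    have hm2 : ((H.graph.awayFrom C).eigenvalueCount t : ℝ) ≤ H.graph.eigenvalueCount t := by
      exact_mod_cast eigenvalueCount_mono (H.graph.awayFrom_le C) t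
    set cG : ℝ := (G.graph.eigenvalueCount t : ℝ)
    set cH : ℝ := (H.graph.eigenvalueCount t : ℝ)
    set cG' : ℝ := ((G.graph.awayFrom B).eigenvalueCount t : ℝ)
    set cH' : ℝ := ((H.graph.awayFrom C).eigenvalueCount t : ℝ)
    have hcH : 0 ≤ cH := Nat.cast_nonneg _
    -- Since cG' = N cH', three errors remain: the edges deleted in G, those deleted in the copies
    -- of H, and the mismatch between |G| and N|H|. The function `g` bounds each separately.
    have hsplit : cG / G.order - cH / H.order
        = (cG - cG') / G.order - N * (cH - cH') / G.order
          + (N * H.order - G.order) / (G.order * H.order) * cH := by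
      rw [hc]
      field_simp
      ring
    rw [hsplit]
    refine (abs_add_le _ _).trans (add_le_add ((abs_sub _ _).trans (add_le_add ?_ ?_)) ?_)
    · rw [abs_of_nonneg (div_nonneg (sub_nonneg.2 hm1) hG'.le)]
    · rw [abs_of_nonneg (div_nonneg (mul_nonneg hN (sub_nonneg.2 hm2)) hG'.le)]
    · rw [abs_mul, abs_div, abs_of_pos (mul_pos hG' hH'), abs_of_nonneg hcH]
      gcongr
  refine (eLpNorm_spectralFunction_sub_le hG hH).trans ?_
  calc ∫⁻ t in Ioi (0 : ℝ), ENNReal.ofReal |(G.graph.eigenvalueCount t : ℝ) / G.order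
        - (H.graph.eigenvalueCount t : ℝ) / H.order|
      ≤ ∫⁻ t in Ioi (0 : ℝ), ENNReal.ofReal (g t) :=
        setLIntegral_mono' measurableSet_Ioi fun t ht => ENNReal.ofReal_le_ofReal (hpt t ht)
    _ = ENNReal.ofReal (∫ t in Ioi (0 : ℝ), g t) := by
        rw [ofReal_integral_eq_lintegral_ofReal hg]
        exact (ae_restrict_iff' measurableSet_Ioi).2 <| Eventually.of_forall fun t ht =>
          (abs_nonneg _).trans (hpt t ht)
    _ ≤ _ := by
        refine ENNReal.ofReal_le_ofReal ?_
        have e1 := G.graph.integral_eigenvalueCount_sub_le B hR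
        have e2 := H.graph.integral_eigenvalueCount_sub_le C hR
        have e3 := H.graph.sum_degree_le_cliqueSum_univ hR
        rw [← integral_eigenvalueCount] at e3
        have hab : 0 ≤ a + N * b := (abs_nonneg _).trans hcard
        calc ∫ t in Ioi (0 : ℝ), g t
            = (∫ t in Ioi (0 : ℝ), ((G.graph.eigenvalueCount t : ℝ)
                - (G.graph.awayFrom B).eigenvalueCount t)) / G.order
              + N * (∫ t in Ioi (0 : ℝ), ((H.graph.eigenvalueCount t : ℝ)
                - (H.graph.awayFrom C).eigenvalueCount t)) / G.order
              + (a + N * b) / (G.order * H.order)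
                * ∫ t in Ioi (0 : ℝ), (H.graph.eigenvalueCount t : ℝ) := by
              rw [← integral_div, ← integral_const_mul, ← integral_const_mul, ← integral_div,
                ← integral_add hi1' hi2']
              exact integral_add (hi1'.add hi2') hi3'
          _ ≤ (2 * a) / G.order + N * (2 * b) / G.order
              + (a + N * b) / (G.order * H.order) * (2 * E) := by
              gcongr
          _ = _ := by
              field_simp

/-! ### Growth rates along the iterated refinement -/

section Iterate

variable {G H : FinGraph.{u}} {d : ℕ}

noncomputable instance (G : FinGraph.{u}) :
    Fintype {s : Finset G.V // s.Nonempty ∧ G.graph.IsClique (s : Set G.V)} :=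
  Fintype.ofFinite _

theorem iterRefine_succ (G : FinGraph.{u}) (m : ℕ) :
    G.iterRefine (m + 1) = (G.iterRefine m).refine :=
  Function.iterate_succ_apply' refine m G

theorem iterRefine_succ' (G : FinGraph.{u}) (m : ℕ) :
    G.iterRefine (m + 1) = G.refine.iterRefine m :=
  Function.iterate_succ_apply refine m G

theorem cliqueFree_iterRefine (hG : G.graph.CliqueFree (d + 2)) (m : ℕ) :
    (G.iterRefine m).graph.CliqueFree (d + 2) := by
  induction m with
  | zero => exact hG
  | succ m ih =>
    rw [iterRefine_succ]
    exact cliqueFree_barycentric ih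

theorem cliqueSum_iterRefine_le (hG : G.graph.CliqueFree (d + 2)) {ε R : ℝ}
    (hR : 1 ≤ R) (hε0 : 0 ≤ ε) (hε : (2 : ℝ) ^ 2 ^ (d + 1) ≤ ε * R) (m : ℕ) :
    (G.iterRefine m).graph.cliqueSum univ (R ^ ·)
      ≤ ((d + 1).factorial + ε) ^ m * G.graph.cliqueSum univ (R ^ ·) := by
  induction m with
  | zero => rw [pow_zero, one_mul]; exact le_rfl
  | succ m ih =>
    rw [iterRefine_succ, pow_succ', mul_assoc]
    have hm := cliqueFree_iterRefine hG m
    have := cliqueSum_barycentric_le hm (B := univ) (flagCount_le_of_cliqueFree hm univ) hR hε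
    rw [refineSet_univ] at this
    exact this.trans (mul_le_mul_of_nonneg_left ih (by positivity))

theorem factorial_pow_mul_cliqueSum_le (G : FinGraph.{u}) (d m : ℕ) :
    ((d + 1).factorial : ℝ) ^ m * G.graph.cliqueSum univ (Pi.single (d + 1) 1)
      ≤ (G.iterRefine m).graph.cliqueSum univ (Pi.single (d + 1) 1) := by
  induction m with
  | zero => rw [pow_zero, one_mul]; exact le_rfl
  | succ m ih =>
    rw [iterRefine_succ, pow_succ', mul_assoc]
    exact (mul_le_mul_of_nonneg_left ih (by positivity)).trans (factorial_mul_cliqueSum_le _ d)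

/-- The shift by one appears because the vertices of G_{m+1} are the cliques of G_m. -/
theorem factorial_pow_le_order {s : Finset G.V} (hs : G.graph.IsNClique (d + 1) s) (m : ℕ) :
    ((d + 1).factorial : ℝ) ^ m ≤ (G.iterRefine (m + 1)).order := by
  have h1 := factorial_pow_mul_cliqueSum_le G d m
  have h2 := one_le_cliqueSum_single hs
  rw [iterRefine_succ]
  exact (le_mul_of_one_le_right (by positivity) h2).trans
    (h1.trans (cliqueSum_single_le_card _ _))

/-- By counting: the number of (d+1)-cliques is multiplied by at least (d+1)!, so it stays positive.
-/
theorem exists_isNClique_refine {s : Finset G.V} (hs : G.graph.IsNClique (d + 1) s) :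
    ∃ t : Finset G.refine.V, G.refine.graph.IsNClique (d + 1) t := by
  by_contra! hcon
  have h1 := factorial_pow_mul_cliqueSum_le G d 1
  have h2 := one_le_cliqueSum_single hs
  have h3 : G.refine.graph.cliqueSum univ (Pi.single (d + 1) 1) = 0 := by
    refine Finset.sum_eq_zero fun t ht => Pi.single_eq_of_ne (fun hc => ?_) _
    exact hcon t ⟨(mem_cliquesMeeting.1 ht).1, hc⟩
  have h4 : (G.iterRefine 1).graph.cliqueSum univ (Pi.single (d + 1) 1) = 0 := h3
  rw [h4] at h1
  have h5 : (0 : ℝ) < (d + 1).factorial := by positivity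
  have : 0 < ((d + 1).factorial : ℝ) ^ 1 * G.graph.cliqueSum univ (Pi.single (d + 1) 1) := by
    positivity
  linarith

/-- The exceptional sets of a patching grow at a smaller rate than the graphs. -/
theorem exists_patchFamily_iterRefine {ι : Type u} {φ : ι → (H.graph ↪g G.graph)} {C : Set H.V}
    {B : Set G.V} (h : PatchFamily φ C B) (hG : G.graph.CliqueFree (d + 2))
    (hH : H.graph.CliqueFree (d + 2))
    (hB : ∀ s : Finset G.V, G.graph.IsNClique (d + 1) s → ¬ (s : Set G.V) ⊆ B)
    (hC : ∀ s : Finset H.V, H.graph.IsNClique (d + 1) s → ¬ (s : Set H.V) ⊆ C) {ε R : ℝ}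
    (hR : 1 ≤ R) (hε0 : 0 ≤ ε) (hε : (2 : ℝ) ^ 2 ^ (d + 1) ≤ ε * R) (m : ℕ) :
    ∃ (φ' : ι → ((H.iterRefine m).graph ↪g (G.iterRefine m).graph)) (C' : Set (H.iterRefine m).V)
      (B' : Set (G.iterRefine m).V), PatchFamily φ' C' B' ∧
      (∀ s : Finset (G.iterRefine m).V, (G.iterRefine m).graph.IsNClique (d + 1) s →
        ¬ (s : Set (G.iterRefine m).V) ⊆ B') ∧
      (∀ s : Finset (H.iterRefine m).V, (H.iterRefine m).graph.IsNClique (d + 1) s →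
        ¬ (s : Set (H.iterRefine m).V) ⊆ C') ∧
      (G.iterRefine m).graph.cliqueSum B' (R ^ ·)
        ≤ ((d + 1).factorial - 1 + ε) ^ m * G.graph.cliqueSum B (R ^ ·) ∧
      (H.iterRefine m).graph.cliqueSum C' (R ^ ·)
        ≤ ((d + 1).factorial - 1 + ε) ^ m * H.graph.cliqueSum C (R ^ ·) := by
  have hq : (0 : ℝ) ≤ (d + 1).factorial - 1 + ε := by
    have : (1 : ℝ) ≤ (d + 1).factorial := by exact_mod_cast (d + 1).factorial_pos
    linarith
  induction m with
  | zero =>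
    refine ⟨φ, C, B, h, hB, hC, ?_, ?_⟩
    · rw [pow_zero, one_mul]; exact le_rfl
    · rw [pow_zero, one_mul]; exact le_rfl
  | succ m ih =>
    obtain ⟨φ', C', B', h', hB', hC', hb, hc⟩ := ih
    have hGm := cliqueFree_iterRefine hG m
    have hHm := cliqueFree_iterRefine hH m
    rw [iterRefine_succ, iterRefine_succ, pow_succ', mul_assoc, mul_assoc]
    exact ⟨_, _, _, h'.barycentric, not_subset_refineSet hGm hB', not_subset_refineSet hHm hC',
      (cliqueSum_barycentric_le hGm (flagCount_le_of_not_subset hGm hB') hR hε).trans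
        (mul_le_mul_of_nonneg_left hb hq),
      (cliqueSum_barycentric_le hHm (flagCount_le_of_not_subset hHm hC') hR hε).trans
        (mul_le_mul_of_nonneg_left hc hq)⟩

/-- The `d`-dimensional simplex as a complete graph. -/
def simplex (d : ℕ) : FinGraph.{u} := ⟨ULift (Fin (d + 1)), ⊤⟩

theorem isNClique_simplex (d : ℕ) :
    (simplex.{u} d).graph.IsNClique (d + 1) (Finset.univ : Finset (ULift (Fin (d + 1)))) := by
  have h : (Finset.univ : Finset (ULift.{u} (Fin (d + 1)))).card = d + 1 := by simp
  exact ⟨fun _ _ _ _ h => h, h⟩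

theorem cliqueFree_simplex (d : ℕ) : (simplex.{u} d).graph.CliqueFree (d + 2) := by
  intro s hs
  have h1 : s.card ≤ Fintype.card (ULift.{u} (Fin (d + 1))) := Finset.card_le_univ s
  rw [hs.card_eq] at h1
  simp at h1

/-- The rate at which the spectral functions approach each other. -/
noncomputable def refineRate (d : ℕ) : ℝ :=
  ((d + 1).factorial - 1 + 1 / 4) * ((d + 1).factorial + 1 / 4)
    / (((d + 1).factorial : ℝ) * (d + 1).factorial)

theorem one_le_factorial (d : ℕ) : (1 : ℝ) ≤ (d + 1).factorial := by
  exact_mod_cast (d + 1).factorial_pos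

theorem refineRate_nonneg (d : ℕ) : 0 ≤ refineRate d := by
  have := one_le_factorial d
  exact div_nonneg (mul_nonneg (by linarith) (by linarith)) (by positivity)

/-- With Q = (d+1)! this says (Q - 3/4)(Q + 1/4) < Q². The choice ε = 1/4 works even for Q = 1, that
is for d = 0. -/
theorem refineRate_lt_one (d : ℕ) : refineRate d < 1 := by
  have := one_le_factorial d
  rw [refineRate, div_lt_one (by positivity)]
  nlinarith

/-- The refinements of all graphs of clique number `d + 1` have asymptotically the same spectral
function. -/
theorem exists_eLpNorm_sub_simplex_le (hG : G.graph.CliqueFree (d + 2)) {s : Finset G.V}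
    (hs : G.graph.IsNClique (d + 1) s) :
    ∃ M : ℝ, 0 ≤ M ∧ ∀ m : ℕ, eLpNorm (fun x => (G.iterRefine (m + 1)).spectralFunction x
        - ((simplex.{u} d).iterRefine (m + 1)).spectralFunction x) 1
        (volume.restrict (Icc (0 : ℝ) 1)) ≤ ENNReal.ofReal (M * refineRate d ^ m) := by
  classical
  obtain ⟨φ, hφ⟩ := exists_patchFamily (W := ULift.{u} (Fin (d + 1))) (by simp) hG
  have hQ := one_le_factorial d
  let _ : Fintype {s : Finset G.V // G.graph.IsNClique (d + 1) s} := Fintype.ofFinite _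
  set N : ℝ := (Fintype.card {s : Finset G.V // G.graph.IsNClique (d + 1) s} : ℝ) with hN
  set Q : ℝ := ((d + 1).factorial : ℝ) with hQdef
  -- Chosen so that 2^2^(d+1) = εR with ε = 1/4.
  set R : ℝ := 4 * (2 : ℝ) ^ 2 ^ (d + 1)
  have hR : 1 ≤ R := by
    have : (1 : ℝ) ≤ (2 : ℝ) ^ 2 ^ (d + 1) := one_le_pow₀ (by norm_num)
    linarith
  have hε : (2 : ℝ) ^ 2 ^ (d + 1) ≤ 1 / 4 * R := by
    change _ ≤ 1 / 4 * (4 * (2 : ℝ) ^ 2 ^ (d + 1))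
    linarith
  set K : FinGraph.{u} := simplex d with hK
  have hRpow : ∀ k : ℕ, 0 ≤ R ^ k := fun k => pow_nonneg (by linarith) k
  set A := G.refine.graph.cliqueSum (G.graph.lowerSimplices d) (R ^ ·)
  set A' := K.refine.graph.cliqueSum (K.graph.lowerSimplices d) (R ^ ·)
  set E := K.refine.graph.cliqueSum univ (R ^ ·)
  have hA : 0 ≤ A := cliqueSum_nonneg _ _ hRpow
  have hA' : 0 ≤ A' := cliqueSum_nonneg _ _ hRpow
  have hE : 0 ≤ E := cliqueSum_nonneg _ _ hRpow
  have hN0 : 0 ≤ N := Nat.cast_nonneg _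
  refine ⟨2 * (A + N * A') * (1 + E), by positivity, fun m => ?_⟩
  have hKfree : K.graph.CliqueFree (d + 2) := cliqueFree_simplex d
  have hoG := factorial_pow_le_order hs m
  have hoK := factorial_pow_le_order (isNClique_simplex.{u} d) m
  rw [← hQdef] at hoG hoK
  have hQm : 0 < Q ^ m := by positivity
  have hGpos : (0 : ℝ) < (G.iterRefine (m + 1)).order := hQm.trans_le hoG
  have hKpos : (0 : ℝ) < (K.iterRefine (m + 1)).order := hQm.trans_le hoK
  obtain ⟨φ', C', B', h', -, -, hb, hc⟩ := exists_patchFamily_iterRefine (G := G.refine)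
    (H := K.refine) (d := d) hφ (cliqueFree_barycentric hG) (cliqueFree_barycentric hKfree)
    (not_subset_lowerSimplices G.graph) (not_subset_lowerSimplices K.graph) hR
    (by norm_num : (0 : ℝ) ≤ 1 / 4) hε m
  have he := cliqueSum_iterRefine_le (G := K.refine) (d := d) (cliqueFree_barycentric hKfree) hR
    (by norm_num : (0 : ℝ) ≤ 1 / 4) hε m
  refine (eLpNorm_spectralFunction_sub_le_of_patchFamily (G := G.iterRefine (m + 1))
    (H := K.iterRefine (m + 1)) (by exact_mod_cast hGpos) (by exact_mod_cast hKpos) h' hR).trans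
    (ENNReal.ofReal_le_ofReal ?_)
  rw [← hN]
  set q : ℝ := Q - 1 + 1 / 4
  have hq : 0 ≤ q := by change 0 ≤ Q - 1 + 1 / 4; linarith
  have hrate : refineRate d = q * (Q + 1 / 4) / (Q * Q) := rfl
  have hab : 2 * ((G.iterRefine (m + 1)).graph.cliqueSum B' (R ^ ·)
      + N * (K.iterRefine (m + 1)).graph.cliqueSum C' (R ^ ·)) ≤ 2 * (A + N * A') * q ^ m := by
    have h1 : (G.iterRefine (m + 1)).graph.cliqueSum B' (R ^ ·) ≤ q ^ m * A := hb
    have h2 : (K.iterRefine (m + 1)).graph.cliqueSum C' (R ^ ·) ≤ q ^ m * A' := hc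
    have h3 := mul_le_mul_of_nonneg_left h2 hN0
    linarith
  have hE' : (K.iterRefine (m + 1)).graph.cliqueSum univ (R ^ ·) ≤ (Q + 1 / 4) ^ m * E := he
  -- The term 1/|G| is weakened to the form of the mismatch term, so that both decay at the common
  -- rate `refineRate d`.
  have h1G : 1 / ((G.iterRefine (m + 1)).order : ℝ) ≤ (Q + 1 / 4) ^ m / (Q ^ m * Q ^ m) := by
    calc 1 / ((G.iterRefine (m + 1)).order : ℝ) ≤ 1 / Q ^ m :=
          one_div_le_one_div_of_le hQm hoG
      _ = Q ^ m / (Q ^ m * Q ^ m) := by field_simp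
      _ ≤ (Q + 1 / 4) ^ m / (Q ^ m * Q ^ m) := by gcongr; linarith
  have h2G : (K.iterRefine (m + 1)).graph.cliqueSum univ (R ^ ·)
      / ((G.iterRefine (m + 1)).order * (K.iterRefine (m + 1)).order)
      ≤ (Q + 1 / 4) ^ m * E / (Q ^ m * Q ^ m) := by
    gcongr
  calc 2 * ((G.iterRefine (m + 1)).graph.cliqueSum B' (R ^ ·)
        + N * (K.iterRefine (m + 1)).graph.cliqueSum C' (R ^ ·))
        * (1 / ((G.iterRefine (m + 1)).order : ℝ)
          + (K.iterRefine (m + 1)).graph.cliqueSum univ (R ^ ·)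
            / ((G.iterRefine (m + 1)).order * (K.iterRefine (m + 1)).order))
      ≤ 2 * (A + N * A') * q ^ m * ((Q + 1 / 4) ^ m / (Q ^ m * Q ^ m)
          + (Q + 1 / 4) ^ m * E / (Q ^ m * Q ^ m)) := by
        have := cliqueSum_nonneg (K.iterRefine (m + 1)).graph univ hRpow
        gcongr
    _ = 2 * (A + N * A') * (1 + E) * refineRate d ^ m := by
        rw [hrate, div_pow, mul_pow, mul_pow]
        field_simp

end Iterate

end FinGraph

/-! ### The L¹ limit and its monotone version -/

section Limit

/-- A sequence with geometrically decreasing increments converges in `L¹`. -/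
theorem exists_tendsto_eLpNorm_of_geometric {α : Type*} [MeasurableSpace α] {μ : Measure α}
    {f : ℕ → α → ℝ} (hf : ∀ n, MemLp (f n) 1 μ) {M r : ℝ} (hM : 0 ≤ M) (hr0 : 0 ≤ r) (hr : r < 1)
    (hfr : ∀ n, eLpNorm (f n - f (n + 1)) 1 μ ≤ ENNReal.ofReal (M * r ^ n)) :
    ∃ g : α → ℝ, MemLp g 1 μ ∧ Tendsto (fun n => eLpNorm (f n - g) 1 μ) atTop (𝓝 0) := by
  have hc : CauchySeq fun n => (hf n).toLp (f n) := by
    refine cauchySeq_of_le_geometric r M hr fun n => ?_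
    rw [Lp.dist_def, eLpNorm_congr_ae ((hf n).coeFn_toLp.sub (hf (n + 1)).coeFn_toLp)]
    exact ENNReal.toReal_le_of_le_ofReal (by positivity) (hfr n)
  obtain ⟨g, hg⟩ := cauchySeq_tendsto_of_complete hc
  refine ⟨g, Lp.memLp g, ?_⟩
  rw [Lp.tendsto_Lp_iff_tendsto_eLpNorm'] at hg
  refine hg.congr fun n => eLpNorm_congr_ae ?_
  exact (hf n).coeFn_toLp.sub (ae_eq_refl _)

/-- A function that is a limit almost everywhere of nonnegative monotone functions has a monotone
right-continuous version. -/
theorem exists_monotoneOn_version {f : ℕ → ℝ → ℝ} (hmono : ∀ n, Monotone (f n))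
    (hnn : ∀ n x, 0 ≤ f n x) {g : ℝ → ℝ}
    (hg : ∀ᵐ x ∂volume.restrict (Icc (0 : ℝ) 1), Tendsto (fun n => f n x) atTop (𝓝 (g x))) :
    ∃ F : ℝ → ℝ, MonotoneOn F (Ico 0 1) ∧
      (∀ x ∈ Ico (0 : ℝ) 1, ContinuousWithinAt F (Ici x) x) ∧
      g =ᵐ[volume.restrict (Icc (0 : ℝ) 1)] F := by
  set S : Set ℝ := {x | x ∈ Ico (0 : ℝ) 1 ∧ Tendsto (fun n => f n x) atTop (𝓝 (g x))}
  have hS : ∀ᵐ x ∂volume.restrict (Icc (0 : ℝ) 1), x ∈ S := by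
    rw [← restrict_Ico_eq_restrict_Icc] at hg ⊢
    filter_upwards [hg, ae_restrict_mem measurableSet_Ico] with x h1 h2 using ⟨h2, h1⟩
  have hgmono : MonotoneOn g S := fun x hx y hy hxy =>
    le_of_tendsto_of_tendsto' hx.2 hy.2 fun n => hmono n hxy
  -- Nonnegativity bounds the infima below also near 0, where S may have no point to the left.
  have hg0 : ∀ x ∈ S, 0 ≤ g x := fun x hx => ge_of_tendsto' hx.2 fun n => hnn n x
  have hbdd : ∀ x, BddBelow (g '' (S ∩ Ioi x)) := fun x =>
    ⟨0, by rintro _ ⟨y, hy, rfl⟩; exact hg0 y hy.1⟩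
  have hne : ∀ x ∈ Ico (0 : ℝ) 1, (S ∩ Ioi x).Nonempty := by
    intro x hx
    by_contra hcon
    rw [not_nonempty_iff_eq_empty] at hcon
    have h1 : volume.restrict (Icc (0 : ℝ) 1) (Ioo x 1) = 0 := by
      refine measure_mono_null ?_ (ae_iff.1 hS)
      intro y hy hyS
      have : y ∈ S ∩ Ioi x := ⟨hyS, hy.1⟩
      rw [hcon] at this
      exact this
    rw [Measure.restrict_apply measurableSet_Ioo, inter_eq_left.2
      (Ioo_subset_Icc_self.trans (Icc_subset_Icc_left hx.1)), Real.volume_Ioo,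
      ENNReal.ofReal_eq_zero] at h1
    linarith [hx.2]
  -- The right limit of g along the points of convergence, which is right-continuous by
  -- construction.
  set F : ℝ → ℝ := fun x => sInf (g '' (S ∩ Ioi x)) with hF
  have hFmono : MonotoneOn F (Ico 0 1) := fun x _ y hy hxy =>
    csInf_le_csInf (hbdd x) ((hne y hy).image g)
      (image_mono (inter_subset_inter_right _ (Ioi_subset_Ioi hxy)))
  have hFle : ∀ x y, y ∈ S → x < y → F x ≤ g y := fun x y hy hxy =>
    csInf_le (hbdd x) ⟨y, ⟨hy, hxy⟩, rfl⟩
  refine ⟨F, hFmono, fun x hx => ?_, ?_⟩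
  · refine tendsto_order.2 ⟨fun a ha => ?_, fun b hb => ?_⟩
    · filter_upwards [self_mem_nhdsWithin, mem_nhdsWithin_of_mem_nhds (Iio_mem_nhds hx.2)]
        with z hz hz1
      exact ha.trans_le (hFmono hx ⟨hx.1.trans hz, hz1⟩ hz)
    · obtain ⟨_, ⟨y, ⟨hyS, hxy⟩, rfl⟩, hy⟩ := exists_lt_of_csInf_lt ((hne x hx).image g) hb
      filter_upwards [mem_nhdsWithin_of_mem_nhds (Iio_mem_nhds hxy)] with z hz
      exact (hFle z y hyS hz).trans_lt hy
  -- At a convergence point, g ≤ F by monotonicity, and F(z) ≤ g(x) for z < x. Letting z tend to x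
  -- gives equality wherever F is continuous, which fails only at countably many points; 0 is
  -- excluded since it cannot be approached from the left.
  · have hcount := hFmono.countable_not_continuousWithinAt
    have h0 : ∀ᵐ x ∂volume.restrict (Icc (0 : ℝ) 1), x ∉
        {x | x ∈ Ico (0 : ℝ) 1 ∧ ¬ContinuousWithinAt F (Ico 0 1) x} ∪ {0} :=
      ae_restrict_of_ae ((hcount.union (countable_singleton 0)).ae_notMem _)
    filter_upwards [hS, h0] with x hx hx0
    have hx0' : 0 < x := lt_of_le_of_ne hx.1.1 fun h => hx0 (Or.inr h.symm)
    have hcont : ContinuousWithinAt F (Ico 0 1) x := by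
      by_contra hcon
      exact hx0 (Or.inl ⟨hx.1, hcon⟩)
    refine le_antisymm ?_ ?_
    · refine le_csInf ((hne x hx.1).image g) ?_
      rintro _ ⟨y, ⟨hyS, hxy⟩, rfl⟩
      exact hgmono hx hyS (le_of_lt hxy)
    · have h1 : Tendsto F (𝓝[Ioo 0 x] x) (𝓝 (F x)) :=
        hcont.mono (Ioo_subset_Ico_self.trans (Ico_subset_Ico_right hx.1.2.le))
      have : (𝓝[Ioo 0 x] x).NeBot := by
        rw [nhdsWithin_Ioo_eq_nhdsLT hx0']
        infer_instance
      refine le_of_tendsto h1 ?_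
      filter_upwards [self_mem_nhdsWithin] with z hz
      exact hFle z x hx hz.2

end Limit

namespace FinGraph

/-- The limit of the spectral functions of the refinements. -/
theorem exists_limit_spectralFunction (d : ℕ) :
    ∃ F : ℝ → ℝ,
      MonotoneOn F (Ico 0 1) ∧
      (∀ x ∈ Ico (0 : ℝ) 1, ContinuousWithinAt F (Ici x) x) ∧
      MemLp F 1 (volume.restrict (Icc (0 : ℝ) 1)) ∧
      ∀ G : FinGraph.{u}, G.graph.cliqueNum = d + 1 →
        Tendsto (fun m : ℕ =>
          eLpNorm (fun x => (G.iterRefine m).spectralFunction x - F x) 1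
            (volume.restrict (Icc (0 : ℝ) 1))) atTop (𝓝 0) := by
  set K : FinGraph.{u} := simplex d
  set ν := volume.restrict (Icc (0 : ℝ) 1)
  set f : ℕ → ℝ → ℝ := fun m => (K.iterRefine (m + 1)).spectralFunction with hf
  have hmem : ∀ m, MemLp (f m) 1 ν := fun m => memLp_spectralFunction _
  obtain ⟨t, ht⟩ := exists_isNClique_refine (isNClique_simplex.{u} d)
  -- Applied to the refined simplex, the comparison bounds the distance between consecutive terms of
  -- its own sequence.
  obtain ⟨M, hM, hMle⟩ := exists_eLpNorm_sub_simplex_le (G := K.refine)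
    (SimpleGraph.cliqueFree_barycentric (cliqueFree_simplex d)) ht
  obtain ⟨g, hg, hgt⟩ := exists_tendsto_eLpNorm_of_geometric hmem hM (refineRate_nonneg d)
    (refineRate_lt_one d) fun m => by
      rw [eLpNorm_sub_comm]
      have := hMle m
      rw [← iterRefine_succ'] at this
      exact this
  obtain ⟨ns, hns, hae⟩ := (tendstoInMeasure_of_tendsto_eLpNorm one_ne_zero
    (fun m => (hmem m).aestronglyMeasurable) hg.aestronglyMeasurable hgt).exists_seq_tendsto_ae
  obtain ⟨F, hF1, hF2, hgF⟩ := exists_monotoneOn_version (f := fun i => f (ns i))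
    (fun i => spectralFunction_mono _) (fun i => spectralFunction_nonneg _) hae
  have hFm : MemLp F 1 ν := hg.ae_eq hgF
  refine ⟨F, hF1, hF2, hFm, fun G hG => ?_⟩
  have hfree : G.graph.CliqueFree (d + 2) := by
    intro s hs
    have h1 := hs.isClique.card_le_cliqueNum
    rw [hs.card_eq, hG] at h1
    omega
  obtain ⟨s, hs⟩ := G.graph.exists_isNClique_cliqueNum
  rw [hG] at hs
  obtain ⟨M', hM', hMle'⟩ := exists_eLpNorm_sub_simplex_le hfree hs
  rw [← tendsto_add_atTop_iff_nat 1]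
  have hlim : Tendsto (fun m : ℕ => ENNReal.ofReal (M' * refineRate d ^ m)
      + eLpNorm (f m - F) 1 ν) atTop (𝓝 0) := by
    have h1 : Tendsto (fun m : ℕ => ENNReal.ofReal (M' * refineRate d ^ m)) atTop (𝓝 0) := by
      rw [← ENNReal.ofReal_zero]
      refine ENNReal.tendsto_ofReal ?_
      simpa using (tendsto_pow_atTop_nhds_zero_of_lt_one (refineRate_nonneg d)
        (refineRate_lt_one d)).const_mul M'
    have h2 : Tendsto (fun m => eLpNorm (f m - F) 1 ν) atTop (𝓝 0) :=
      hgt.congr fun m => eLpNorm_congr_ae ((ae_eq_refl _).sub hgF)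
    simpa using h1.add h2
  refine tendsto_of_tendsto_of_tendsto_of_le_of_le tendsto_const_nhds hlim
    (fun _ => zero_le) fun m => ?_
  have hsplit : (fun x => (G.iterRefine (m + 1)).spectralFunction x - F x)
      = (fun x => (G.iterRefine (m + 1)).spectralFunction x - f m x) + (f m - F) := by
    ext x
    simp
  rw [hsplit]
  refine (eLpNorm_add_le ?_ ?_ le_rfl).trans (add_le_add (hMle' m) le_rfl)
  · exact ((memLp_spectralFunction _).sub (hmem m)).aestronglyMeasurable
  · exact ((hmem m).sub hFm).aestronglyMeasurable

end FinGraph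

/-! ### The derivative measure of a monotone function -/

section DensityOfStates

variable {F : ℝ → ℝ}

/-- The range of values that `F` jumps over or passes through on `(0, 1)`. -/
def valueRange (F : ℝ → ℝ) : Set ℝ := {t | F 0 < t ∧ ∃ x ∈ Ico (0 : ℝ) 1, t ≤ F x}

/-- The generalized inverse of a monotone function on `[0, 1)`. -/
noncomputable def generalizedInverse (F : ℝ → ℝ) (t : ℝ) : ℝ :=
  sInf {x | x ∈ Ico (0 : ℝ) 1 ∧ t ≤ F x}

/-- The image of Lebesgue measure under the generalized inverse. -/
noncomputable def densityOfStates (F : ℝ → ℝ) : Measure ℝ :=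
  (volume.restrict (valueRange F)).map (generalizedInverse F)

theorem measurableSet_valueRange : MeasurableSet (valueRange F) := by
  refine OrdConnected.measurableSet ⟨?_⟩
  rintro s ⟨hs, -⟩ t ⟨-, x, hx, ht⟩ u hu
  exact ⟨hs.trans_le hu.1, x, hx, hu.2.trans ht⟩

theorem bddBelow_superlevel (t : ℝ) : BddBelow {x | x ∈ Ico (0 : ℝ) 1 ∧ t ≤ F x} :=
  ⟨0, fun _ hx => hx.1.1⟩

theorem aemeasurable_generalizedInverse :
    AEMeasurable (generalizedInverse F) (volume.restrict (valueRange F)) := by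
  refine aemeasurable_restrict_of_monotoneOn measurableSet_valueRange ?_
  rintro s - t ⟨-, x, hx, ht⟩ hst
  exact csInf_le_csInf (bddBelow_superlevel s) ⟨x, hx, ht⟩ fun y hy => ⟨hy.1, hst.trans hy.2⟩

/-- Right-continuity is what makes the infimum attained: if F(x) < t, then F stays below t a little
to the right of x, so the infimum exceeds x. All statements about the image measure reduce to this
equivalence. -/
theorem generalizedInverse_le_iff (hF : MonotoneOn F (Ico 0 1))
    (hFc : ∀ x ∈ Ico (0 : ℝ) 1, ContinuousWithinAt F (Ici x) x) {t : ℝ} (ht : t ∈ valueRange F)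
    {x : ℝ} (hx : x ∈ Ico (0 : ℝ) 1) : generalizedInverse F t ≤ x ↔ t ≤ F x := by
  constructor
  · intro h
    by_contra! hlt
    have h1 : ∀ᶠ z in 𝓝[≥] x, F z < t := (hFc x hx).eventually_lt_const hlt
    obtain ⟨y, hxy, hy⟩ := (mem_nhdsGE_iff_exists_Ico_subset' hx.2).1 h1
    obtain ⟨-, x₀, hx₀, htx₀⟩ := ht
    have : y ≤ generalizedInverse F t := by
      refine le_csInf ⟨x₀, hx₀, htx₀⟩ fun z hz => ?_
      by_contra! hzy
      rcases le_or_gt x z with hxz | hzx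
      · exact absurd hz.2 (not_le.2 (hy ⟨hxz, hzy⟩))
      · exact absurd (hz.2.trans (hF hz.1 hx hzx.le)) (not_le.2 hlt)
    exact absurd (this.trans h) (not_le.2 hxy)
  · intro h
    exact csInf_le (bddBelow_superlevel t) ⟨hx, h⟩

theorem generalizedInverse_mem_Ioo (hF : MonotoneOn F (Ico 0 1))
    (hFc : ∀ x ∈ Ico (0 : ℝ) 1, ContinuousWithinAt F (Ici x) x) {t : ℝ} (ht : t ∈ valueRange F) :
    generalizedInverse F t ∈ Ioo (0 : ℝ) 1 := by
  constructor
  · by_contra! h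
    exact absurd ((generalizedInverse_le_iff hF hFc ht ⟨le_rfl, one_pos⟩).1 h) (not_le.2 ht.1)
  · obtain ⟨-, x, hx, htx⟩ := id ht
    exact ((generalizedInverse_le_iff hF hFc ht hx).2 htx).trans_lt hx.2

theorem densityOfStates_compl_Ioo (hF : MonotoneOn F (Ico 0 1))
    (hFc : ∀ x ∈ Ico (0 : ℝ) 1, ContinuousWithinAt F (Ici x) x) :
    densityOfStates F (Ioo (0 : ℝ) 1)ᶜ = 0 := by
  rw [densityOfStates, Measure.map_apply_of_aemeasurable aemeasurable_generalizedInverse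
    measurableSet_Ioo.compl]
  have h : ∀ᵐ t ∂volume.restrict (valueRange F), generalizedInverse F t ∈ Ioo (0 : ℝ) 1 :=
    (ae_restrict_iff' measurableSet_valueRange).2 (Eventually.of_forall fun t ht =>
      generalizedInverse_mem_Ioo hF hFc ht)
  exact ae_iff.1 h

theorem valueRange_inter_preimage_Ioc (hF : MonotoneOn F (Ico 0 1))
    (hFc : ∀ x ∈ Ico (0 : ℝ) 1, ContinuousWithinAt F (Ici x) x) {a b : ℝ} (ha : 0 ≤ a)
    (hab : a ≤ b) (hb : b < 1) :
    generalizedInverse F ⁻¹' Ioc a b ∩ valueRange F = Ioc (F a) (F b) := by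
  have ha' : a ∈ Ico (0 : ℝ) 1 := ⟨ha, hab.trans_lt hb⟩
  have hb' : b ∈ Ico (0 : ℝ) 1 := ⟨ha.trans hab, hb⟩
  ext t
  constructor
  · rintro ⟨⟨h1, h2⟩, ht⟩
    exact ⟨not_le.1 fun h => absurd ((generalizedInverse_le_iff hF hFc ht ha').2 h)
      (not_le.2 h1), (generalizedInverse_le_iff hF hFc ht hb').1 h2⟩
  · rintro ⟨h1, h2⟩
    have ht : t ∈ valueRange F := ⟨(hF ⟨le_rfl, one_pos⟩ ha' ha).trans_lt h1, b, hb', h2⟩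
    exact ⟨⟨not_le.1 fun h => absurd ((generalizedInverse_le_iff hF hFc ht ha').1 h)
      (not_le.2 h1), (generalizedInverse_le_iff hF hFc ht hb').2 h2⟩, ht⟩

theorem densityOfStates_Ioc (hF : MonotoneOn F (Ico 0 1))
    (hFc : ∀ x ∈ Ico (0 : ℝ) 1, ContinuousWithinAt F (Ici x) x) {a b : ℝ} (ha : 0 ≤ a)
    (hab : a ≤ b) (hb : b < 1) :
    densityOfStates F (Ioc a b) = ENNReal.ofReal (F b - F a) := by
  rw [densityOfStates, Measure.map_apply_of_aemeasurable aemeasurable_generalizedInverse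
    measurableSet_Ioc, Measure.restrict_apply₀' measurableSet_valueRange.nullMeasurableSet,
    valueRange_inter_preimage_Ioc hF hFc ha hab hb, Real.volume_Ioc]

theorem exists_tsupport_subset_Ioc {φ : ℝ → ℝ} (hφc : HasCompactSupport φ)
    (hφs : tsupport φ ⊆ Ioo (0 : ℝ) 1) : ∃ b, 0 ≤ b ∧ b < 1 ∧ tsupport φ ⊆ Ioc 0 b := by
  rcases (tsupport φ).eq_empty_or_nonempty with h | h
  · exact ⟨0, le_rfl, one_pos, by simp [h]⟩
  · obtain ⟨b, hb, hmax⟩ := hφc.isCompact.exists_isGreatest h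
    exact ⟨b, (hφs hb).1.le, (hφs hb).2, fun x hx => ⟨(hφs hx).1, hmax hx⟩⟩

/-- The density of states is the distributional derivative of `F`. -/
theorem integral_densityOfStates (hF : MonotoneOn F (Ico 0 1))
    (hFc : ∀ x ∈ Ico (0 : ℝ) 1, ContinuousWithinAt F (Ici x) x) {φ : ℝ → ℝ}
    (hφ : ContDiff ℝ 1 φ) (hφc : HasCompactSupport φ) (hφs : tsupport φ ⊆ Ioo (0 : ℝ) 1) :
    Integrable φ (densityOfStates F) ∧
      ∫ x, φ x ∂densityOfStates F = - ∫ x in (0 : ℝ)..1, deriv φ x * F x := by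
  -- Cutting off at b < 1 keeps all quantities finite, as F may be unbounded near 1.
  obtain ⟨b, hb0, hb1, hb⟩ := exists_tsupport_subset_Ioc hφc hφs
  have hbI : b ∈ Ico (0 : ℝ) 1 := ⟨hb0, hb1⟩
  have h0I : (0 : ℝ) ∈ Ico (0 : ℝ) 1 := ⟨le_rfl, one_pos⟩
  have hφ0 : ∀ x, x ∉ Ioc 0 b → φ x = 0 := fun x hx =>
    image_eq_zero_of_notMem_tsupport fun h => hx (hb h)
  have hd0 : ∀ x, x ∉ Ioc 0 b → deriv φ x = 0 := fun x hx =>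
    image_eq_zero_of_notMem_tsupport fun h => hx (hb (tsupport_deriv_subset h))
  have hdc : Continuous (deriv φ) := hφ.continuous_deriv le_rfl
  constructor
  · obtain ⟨C, hC⟩ := hφc.exists_bound_of_continuous hφ.continuous
    rw [← integrableOn_iff_integrable_of_support_subset (s := Ioc 0 b)
      ((subset_tsupport φ).trans hb)]
    refine Measure.integrableOn_of_bounded (M := C) ?_ hφ.continuous.aestronglyMeasurable
      (Eventually.of_forall hC)
    rw [densityOfStates_Ioc hF hFc le_rfl hb0 hb1]
    exact ENNReal.ofReal_ne_top
  obtain ⟨D, hD⟩ := hφc.deriv.exists_bound_of_continuous hdc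
  -- F is monotone only on [0,1); clamping the argument gives a function monotone, hence measurable,
  -- on the whole line.
  let E : ℝ → ℝ := fun x => F (max 0 (min x b))
  have hmaxI : ∀ x, max 0 (min x b) ∈ Ico (0 : ℝ) 1 := fun x =>
    ⟨le_max_left _ _, max_lt one_pos ((min_le_right _ _).trans_lt hb1)⟩
  have hEmono : Monotone E := fun x y h => hF (hmaxI x) (hmaxI y) (by gcongr)
  have hE : ∀ x ∈ Ioc 0 b, E x = F x := fun x hx => by
    change F (max 0 (min x b)) = F x
    rw [min_eq_left hx.2, max_eq_right hx.1.le]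
  let h : ℝ → ℝ → ℝ := fun t x => {p : ℝ × ℝ | p.1 ≤ E p.2}.indicator (fun p => deriv φ p.2) (t, x)
  have hmeas : MeasurableSet {p : ℝ × ℝ | p.1 ≤ E p.2} := by
    have : Measurable fun p : ℝ × ℝ => E p.2 := hEmono.measurable.comp measurable_snd
    exact measurableSet_le measurable_fst this
  have hint : Integrable (Function.uncurry h) ((volume.restrict (Ioc (F 0) (F b))).prod
      (volume.restrict (Ioc 0 b))) := by
    have hm : Measurable (Function.uncurry h) :=
      (hdc.measurable.comp measurable_snd).indicator hmeas
    refine Integrable.of_bound hm.aestronglyMeasurable D (Eventually.of_forall fun p => ?_)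
    exact (norm_indicator_le_norm_self (fun p : ℝ × ℝ => deriv φ p.2) p).trans (hD p.2)
  -- Slicing the region t ≤ F(x) at height t leaves the half-line to the right of the generalized
  -- inverse, over which φ' integrates to -φ at its end.
  have hleft : ∀ t ∈ Ioc (F 0) (F b), ∫ x in Ioc 0 b, h t x = - φ (generalizedInverse F t) := by
    intro t ht
    have htv : t ∈ valueRange F := ⟨ht.1, b, hbI, ht.2⟩
    rw [← hφc.integral_Ioi_deriv_eq hφ, ← integral_Ici_eq_integral_Ioi,
      ← integral_indicator measurableSet_Ioc, ← integral_indicator measurableSet_Ici]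
    congr 1
    ext x
    by_cases hx : x ∈ Ioc 0 b
    · have hiff := generalizedInverse_le_iff hF hFc htv ⟨hx.1.le, hx.2.trans_lt hb1⟩
      rw [indicator_of_mem hx]
      by_cases htx : t ≤ F x
      · rw [indicator_of_mem (mem_Ici.2 (hiff.2 htx))]
        exact indicator_of_mem (by change t ≤ E x; rwa [hE x hx]) _
      · rw [indicator_of_notMem fun hm => htx (hiff.1 (mem_Ici.1 hm))]
        exact indicator_of_notMem (by change ¬ t ≤ E x; rwa [hE x hx]) _
    · rw [indicator_of_notMem hx, indicator_apply, hd0 x hx, ite_self]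
  have hright : ∀ x ∈ Ioc 0 b, ∫ t in Ioc (F 0) (F b), h t x = deriv φ x * F x
      - F 0 * deriv φ x := by
    intro x hx
    have hxI : x ∈ Ico (0 : ℝ) 1 := ⟨hx.1.le, hx.2.trans_lt hb1⟩
    have : ∀ t, h t x = (Iic (F x)).indicator (fun _ => deriv φ x) t := fun t => by
      simp only [h, indicator_apply, mem_Iic, mem_ofPred_eq, hE x hx]
    simp_rw [this]
    rw [setIntegral_indicator measurableSet_Iic, setIntegral_const, smul_eq_mul]
    have hset : Ioc (F 0) (F b) ∩ Iic (F x) = Ioc (F 0) (F x) := by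
      rw [Ioc_inter_Iic, min_eq_right (hF hxI hbI hx.2)]
    rw [hset, Real.volume_real_Ioc_of_le (hF h0I hxI hx.1.le)]
    ring
  have hswap := integral_integral_swap hint
  rw [setIntegral_congr_fun measurableSet_Ioc hleft, setIntegral_congr_fun measurableSet_Ioc hright]
    at hswap
  have hmap : ∫ x, φ x ∂densityOfStates F
      = ∫ t in Ioc (F 0) (F b), φ (generalizedInverse F t) := by
    rw [densityOfStates, integral_map aemeasurable_generalizedInverse
      hφ.continuous.aestronglyMeasurable]
    refine (setIntegral_eq_of_subset_of_forall_sdiff_eq_zero measurableSet_valueRange ?_ ?_)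
    · exact fun t ht => ⟨ht.1, b, hbI, ht.2⟩
    · rintro t ⟨htv, ht⟩
      refine hφ0 _ fun hm => ht ⟨htv.1, ?_⟩
      exact (generalizedInverse_le_iff hF hFc htv hbI).1 hm.2
  have hFint : IntegrableOn F (Ioc 0 b) :=
    ((hF.mono (Icc_subset_Ico_right hb1)).integrableOn_isCompact isCompact_Icc).mono_set
      Ioc_subset_Icc_self
  have hprod : IntegrableOn (fun x => deriv φ x * F x) (Ioc 0 b) :=
    hFint.bdd_mul hdc.aestronglyMeasurable (Eventually.of_forall hD)
  have hdint : IntegrableOn (deriv φ) (Ioc 0 b) :=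
    (hdc.integrable_of_hasCompactSupport hφc.deriv).integrableOn
  -- This removes the term with F 0, which arises because the values t start at F 0 and not at 0.
  have hzero : ∫ x in Ioc 0 b, deriv φ x = 0 := by
    have h1 := hφc.integral_Ioi_deriv_eq hφ 0
    rw [hφ0 0 (by simp), neg_zero] at h1
    refine Eq.trans ?_ h1
    exact (setIntegral_eq_of_subset_of_forall_sdiff_eq_zero measurableSet_Ioi
      Ioc_subset_Ioi_self fun x hx => hd0 x hx.2).symm
  rw [integral_sub hprod (hdint.const_mul _), integral_const_mul, hzero, mul_zero, sub_zero,
    integral_neg] at hswap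
  rw [hmap, intervalIntegral.integral_of_le zero_le_one,
    setIntegral_eq_of_subset_of_forall_sdiff_eq_zero measurableSet_Ioc
      (Ioc_subset_Ioc_right hb1.le) fun x hx => by rw [hd0 x hx.2, zero_mul]]
  linarith

/-- A measure concentrated on `(0, 1)` is determined by the increments of `F`. -/
theorem measure_eq_of_Ioc {μ ν : Measure ℝ} (hμ0 : μ (Ioo (0 : ℝ) 1)ᶜ = 0)
    (hν0 : ν (Ioo (0 : ℝ) 1)ᶜ = 0)
    (hμ : ∀ a b : ℝ, 0 ≤ a → a ≤ b → b < 1 → μ (Ioc a b) = ENNReal.ofReal (F b - F a))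
    (hν : ∀ a b : ℝ, 0 ≤ a → a ≤ b → b < 1 → ν (Ioc a b) = ENNReal.ofReal (F b - F a)) :
    μ = ν := by
  have hres : ∀ n : ℕ, μ.restrict (Ioc 0 (1 - 1 / ((n : ℝ) + 1)))
      = ν.restrict (Ioc 0 (1 - 1 / ((n : ℝ) + 1))) := by
    intro n
    set c : ℝ := 1 - 1 / ((n : ℝ) + 1)
    have hc1 : c < 1 := sub_lt_self _ (by positivity)
    have hc0 : 0 ≤ c := sub_nonneg.2 ((div_le_one (by positivity)).2 (by simp))
    have : IsFiniteMeasure (μ.restrict (Ioc 0 c)) := ⟨by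
      rw [Measure.restrict_apply_univ, hμ 0 c le_rfl hc0 hc1]
      exact ENNReal.ofReal_lt_top⟩
    -- On (0,c] both measures are finite, so half-open intervals determine them; these pieces
    -- exhaust (0,1).
    refine Measure.ext_of_Ioc _ _ fun a b _ => ?_
    rw [Measure.restrict_apply measurableSet_Ioc, Measure.restrict_apply measurableSet_Ioc,
      Ioc_inter_Ioc]
    rcases le_or_gt (max a 0) (min b c) with h | h
    · rw [hμ _ _ (le_max_right _ _) h ((min_le_right _ _).trans_lt hc1),
        hν _ _ (le_max_right _ _) h ((min_le_right _ _).trans_lt hc1)]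
    · rw [Ioc_eq_empty_of_le h.le, measure_empty, measure_empty]
  have hunion : ⋃ n : ℕ, Ioc (0 : ℝ) (1 - 1 / ((n : ℝ) + 1)) = Ioo 0 1 := by
    ext x
    rw [mem_iUnion]
    constructor
    · rintro ⟨n, h1, h2⟩
      exact ⟨h1, h2.trans_lt (sub_lt_self _ (by positivity))⟩
    · rintro ⟨h1, h2⟩
      obtain ⟨n, hn⟩ := exists_nat_one_div_lt (sub_pos.2 h2)
      exact ⟨n, h1, by linarith⟩
  have hI := Measure.restrict_iUnion_congr.2 hres
  rw [hunion] at hI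
  rwa [Measure.restrict_eq_self_of_ae_mem (ae_iff.2 hμ0),
    Measure.restrict_eq_self_of_ae_mem (ae_iff.2 hν0)] at hI

end DensityOfStates
theorem mainTheorem12 (d : ℕ) :
    ∃ F : ℝ → ℝ,
      MonotoneOn F (Ico 0 1) ∧
      (∀ x ∈ Ico (0 : ℝ) 1, ContinuousWithinAt F (Ici x) x) ∧
      MemLp F 1 (volume.restrict (Icc (0 : ℝ) 1)) ∧
      (∀ G : FinGraph.{u}, G.graph.cliqueNum = d + 1 →
        Tendsto (fun m : ℕ =>
          eLpNorm (fun x => (G.iterRefine m).spectralFunction x - F x) 1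
            (volume.restrict (Icc (0 : ℝ) 1))) atTop (𝓝 0)) ∧
      ∃! μ : Measure ℝ,
        μ (Ioo (0 : ℝ) 1)ᶜ = 0 ∧
        (∀ a b : ℝ, 0 ≤ a → a ≤ b → b < 1 → μ (Ioc a b) = ENNReal.ofReal (F b - F a)) ∧
        (∀ φ : ℝ → ℝ, ContDiff ℝ ((⊤ : ℕ∞) : WithTop ℕ∞) φ → HasCompactSupport φ →
          tsupport φ ⊆ Ioo (0 : ℝ) 1 →
          Integrable φ μ ∧ ∫ x, φ x ∂μ = - ∫ x in (0 : ℝ)..1, deriv φ x * F x) := by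
  obtain ⟨F, hF, hFc, hFm, hlim⟩ := FinGraph.exists_limit_spectralFunction.{u} d
  refine ⟨F, hF, hFc, hFm, hlim, densityOfStates F,
    ⟨densityOfStates_compl_Ioo hF hFc, fun a b => densityOfStates_Ioc hF hFc,
      fun φ hφ => integral_densityOfStates hF hFc (hφ.of_le (by exact_mod_cast le_top))⟩, ?_⟩
  rintro ν ⟨hν0, hν, -⟩
  exact measure_eq_of_Ioc hν0 (densityOfStates_compl_Ioo hF hFc) hν
    fun a b => densityOfStates_Ioc hF hFc
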